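/- Let $n,d$ be the column dimensions and let $a_i=a_{0i}+\tilde a_i\in\mathbb{R}^n$, $b_i=X_0^\top a_{0i}+\tilde b_i\in\mathbb{R}^d$, $i=1,2,\dots$, where $X_0\in\mathbb{R}^{n\times d}$ is the true parameter, the $a_{0i}$ are nonrandom and $\tilde c_i=(\tilde a_i^\top,\tilde b_i^\top)^\top=(\tilde c_{ij})_{1\le j\le n+d}$ are random errors. Put $c_i=(a_i^\top,b_i^\top)^\top$, let $C=[A,B]$ be the matrix with rows $c_1^\top,\dots,c_m^\top$ and $A_0$ the matrix with rows $a_{01}^\top,\dots,a_{0m}^\top$. For $X\in\mathbb{R}^{n\times d}$ let $Z=Z(X)=\begin{bmatrix}X\\-I_d\end{bmatrix}$, and for $J\subset\{1,\dots,n+d\}$ let $Z_J$ consist of the rows of $Z$ with index in $J$. Assume: (i) the vectors $\tilde c_i$ are independent, with zero mean and finite second moments; (ii) for a fixed set $J$, $E\tilde c_{ij}^2=0$ for all $i$ and all $j\notin J$, and $\operatorname{cov}(\tilde c_{ij},\,j\in J)=\sigma^2\Sigma_i$ for all $i$, with $\sigma^2>0$ unknown and the matrices $\Sigma_i$ known;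 (iii) there is $\varkappa>0$ with $\lambda_{\min}(\Sigma_i)\ge\varkappa^2$ for all $i$; (iv) $\operatorname{rank} Z_J(X_0)=d$; (v) there is $r\ge2$ with $r>d\left(|J|-\frac{d+1}{2}\right)$ and $\sup_{i\ge1,\,j\in J}E|\tilde c_{ij}|^{2r}<\infty$; (vi) $\lambda_{\min}(A_0^\top A_0)/\sqrt m\to\infty$ as $m\to\infty$; (vii) $\lambda_{\min}^2(A_0^\top A_0)/\lambda_{\max}(A_0^\top A_0)\to\infty$ as $m\to\infty$. For each $m$ let $\hat X$ be an element-wise weighted total least squares estimator: a Borel measurable map of the data matrix $C$ into $\mathbb{R}^{n\times d}\cup\{\infty\}$ whose value is the $X$-component of a solution of $$\min_{X,\ \Delta C=[\Delta A,\Delta B]}\ \sum_{i=1}^m\bigl\|\Sigma_i^{-1/2}(\Delta c_{ij})_{j\in J}\bigr\|^2$$ subject to $(A-\Delta A)X=B-\Delta B$, $\Delta c_{ij}=0$ for $j\notin J$, and $\operatorname{rank}Z_J(X)=d$, whenever a solution exists, and is $\infty$ otherwise. Let $S_i=\sigma^{-2}\operatorname{cov}(\tilde c_i)$. For $a\in\mathbb{R}^n$,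 $b\in\mathbb{R}^d$, $c=(a^\top,b^\top)^\top$ and a matrix $S\in\mathbb{R}^{(n+d)\times(n+d)}$ whose first $n$ rows are $[S_a,S_{ab}]$, let $$q(c,S;X)=c^\top Z(Z^\top SZ)^{-1}Z^\top c,$$ $$s(a,b,S;X)=\Bigl(ac^\top Z-[S_a,S_{ab}]Z(Z^\top SZ)^{-1}Z^\top cc^\top Z\Bigr)(Z^\top SZ)^{-1}.$$ For every $i$, $a$, $b$ and every $X$ with $\operatorname{rank}Z_J(X)=d$, $s(a,b,S_i;X)$ is half the gradient of $q(c,S_i;\cdot)$ at $X$ with respect to the inner product $\langle F,G\rangle=\operatorname{tr}(FG^\top)$. Moreover: (a) With probability tending to one as $m\to\infty$, $\hat X$ is finite, satisfies $\operatorname{rank}Z_J(\hat X)=d$, and solves $\sum_{i=1}^m s(a_i,b_i,S_i;X)=0$. (b) The estimating function $s$ is unbiased: for each $i\ge1$, $E_{X_0}\,s(a_i,b_i,S_i;X_0)=0$ (the expectation exists). -/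

import Mathlib

open MeasureTheory ProbabilityTheory Filter Topology

namespace EWTLS

noncomputable section

/-- Smallest eigenvalue of a (symmetric) real matrix. -/
def lambdaMin {ι : Type*} [Fintype ι] [DecidableEq ι] (M : Matrix ι ι ℝ) : ℝ :=
  sInf (spectrum ℝ M)

/-- Largest eigenvalue of a (symmetric) real matrix. -/
def lambdaMax {ι : Type*} [Fintype ι] [DecidableEq ι] (M : Matrix ι ι ℝ) : ℝ :=
  sSup (spectrum ℝ M)

/-- Covariance matrix of a random vector. -/
def covMat {Ω ι : Type*} [MeasurableSpace Ω] (μ : Measure Ω) (v : Ω → ι → ℝ) : Matrix ι ι ℝ :=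
  Matrix.of fun j k => cov[fun ω => v ω j, fun ω => v ω k; μ]

variable {m n d : ℕ}

/-- `Z(X) = [X; -I_d]`. The `n + d` columns of `C = [A, B]` are indexed by `Fin n ⊕ Fin d`. -/
def Zmat (X : Matrix (Fin n) (Fin d) ℝ) : Matrix (Fin n ⊕ Fin d) (Fin d) ℝ :=
  Matrix.fromRows X (-1)

/-- `Z_J(X)`: the rows of `Z(X)` with index in `J`. -/
def ZJ (J : Finset (Fin n ⊕ Fin d)) (X : Matrix (Fin n) (Fin d) ℝ) : Matrix J (Fin d) ℝ :=
  (Zmat X).submatrix Subtype.val id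

/-- The true row `c₀ᵢ = (a₀ᵢ, b₀ᵢ)` with `b₀ᵢ = X₀ᵀ a₀ᵢ`. -/
def trueRow (X₀ : Matrix (Fin n) (Fin d) ℝ) (a₀ : Fin n → ℝ) : Fin n ⊕ Fin d → ℝ :=
  Sum.elim a₀ (Matrix.mulVec X₀.transpose a₀)

/-- The observed row `cᵢ = c₀ᵢ + c̃ᵢ`. -/
def obsRow (X₀ : Matrix (Fin n) (Fin d) ℝ) (a₀ : Fin n → ℝ) (err : Fin n ⊕ Fin d → ℝ) :
    Fin n ⊕ Fin d → ℝ :=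
  trueRow X₀ a₀ + err

/-- The true input matrix `A₀`, formed by the first `m` rows. -/
def inputMat (a₀ : ℕ → Fin n → ℝ) (m : ℕ) : Matrix (Fin m) (Fin n) ℝ :=
  Matrix.of fun i j => a₀ i j

/-- The observed data matrix `C = [A, B]`, formed by the first `m` rows. -/
def dataMat (X₀ : Matrix (Fin n) (Fin d) ℝ) (a₀ : ℕ → Fin n → ℝ)
    (err : ℕ → Fin n ⊕ Fin d → ℝ) (m : ℕ) : Matrix (Fin m) (Fin n ⊕ Fin d) ℝ :=
  Matrix.of fun i => obsRow X₀ (a₀ i) (err i)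

section Problem

open scoped MatrixOrder

/-- The weighted sum of squared corrections `∑ᵢ ‖Σᵢ^{-1/2} Δcᵢᴶ‖²`, with the Euclidean norm and
the positive semidefinite square root. -/
def cost (J : Finset (Fin n ⊕ Fin d)) (Sig : Fin m → Matrix J J ℝ)
    (ΔC : Matrix (Fin m) (Fin n ⊕ Fin d) ℝ) : ℝ :=
  ∑ i, ‖WithLp.toLp 2 (Matrix.mulVec (CFC.sqrt (Sig i))⁻¹ (fun j : J => ΔC i j))‖ ^ 2

end Problem

/-- The constraints on `(X, ΔA, ΔB)`, where `ΔC = [ΔA, ΔB]`, including `rank Z_J(X) = d`. -/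
structure Feasible (J : Finset (Fin n ⊕ Fin d)) (C : Matrix (Fin m) (Fin n ⊕ Fin d) ℝ)
    (X : Matrix (Fin n) (Fin d) ℝ) (ΔC : Matrix (Fin m) (Fin n ⊕ Fin d) ℝ) : Prop where
  eq : (C.toCols₁ - ΔC.toCols₁) * X = C.toCols₂ - ΔC.toCols₂
  zero : ∀ i, ∀ j ∉ J, ΔC i j = 0
  rank : (ZJ J X).rank = d

/-- `X` is the matrix component of a solution of the EW-TLS problem for the data `C`. -/
def IsSolution (J : Finset (Fin n ⊕ Fin d)) (Sig : Fin m → Matrix J J ℝ)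
    (C : Matrix (Fin m) (Fin n ⊕ Fin d) ℝ) (X : Matrix (Fin n) (Fin d) ℝ) : Prop :=
  ∃ ΔC, Feasible J C X ΔC ∧
    ∀ X' ΔC', Feasible J C X' ΔC' → cost J Sig ΔC ≤ cost J Sig ΔC'

/-- An EW-TLS estimator based on `m` rows: a Borel map of the data matrix into `ℝ^{n×d} ∪ {∞}`
whose value solves the EW-TLS problem if there is a solution, and is `∞` otherwise. -/
structure IsEstimator (J : Finset (Fin n ⊕ Fin d)) (Sig : Fin m → Matrix J J ℝ)
    (est : Matrix (Fin m) (Fin n ⊕ Fin d) ℝ → OnePoint (Matrix (Fin n) (Fin d) ℝ)) : Prop where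
  measurable : @Measurable _ _ (borel _) (borel _) est
  solves : ∀ C, (∃ X, IsSolution J Sig C X) →
    ∃ X : Matrix (Fin n) (Fin d) ℝ, est C = (X : OnePoint _) ∧ IsSolution J Sig C X
  infinite : ∀ C, (¬ ∃ X, IsSolution J Sig C X) → est C = OnePoint.infty

/-- `q(c, S; X) = cᵀ Z (Zᵀ S Z)⁻¹ Zᵀ c`. -/
def q (c : Fin n ⊕ Fin d → ℝ) (S : Matrix (Fin n ⊕ Fin d) (Fin n ⊕ Fin d) ℝ)
    (X : Matrix (Fin n) (Fin d) ℝ) : ℝ :=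
  dotProduct c (Matrix.mulVec
    (Zmat X * ((Zmat X).transpose * S * Zmat X)⁻¹ * (Zmat X).transpose) c)

/-- `s̃ = a cᵀ Z - [S_a, S_ab] Z (Zᵀ S Z)⁻¹ Zᵀ c cᵀ Z`, where `c = (a, b)` and
`[S_a, S_ab]` consists of the first `n` rows of `S`. -/
def sTilde (a : Fin n → ℝ) (b : Fin d → ℝ) (S : Matrix (Fin n ⊕ Fin d) (Fin n ⊕ Fin d) ℝ)
    (X : Matrix (Fin n) (Fin d) ℝ) : Matrix (Fin n) (Fin d) ℝ :=
  Matrix.vecMulVec a (Sum.elim a b) * Zmat X -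
    S.toRows₁ * Zmat X * ((Zmat X).transpose * S * Zmat X)⁻¹ * (Zmat X).transpose *
      Matrix.vecMulVec (Sum.elim a b) (Sum.elim a b) * Zmat X

/-- The estimating function `s = s̃ (Zᵀ S Z)⁻¹`. -/
def s (a : Fin n → ℝ) (b : Fin d → ℝ) (S : Matrix (Fin n ⊕ Fin d) (Fin n ⊕ Fin d) ℝ)
    (X : Matrix (Fin n) (Fin d) ℝ) : Matrix (Fin n) (Fin d) ℝ :=
  sTilde a b S X * ((Zmat X).transpose * S * Zmat X)⁻¹

end

end EWTLS

/-! For fixed `X` of full rank the constraint only prescribes `Z_Jᵀ Δcᵢ = Zᵀ cᵢ`, row by row, so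
generalised least squares eliminates `ΔC`: the minimal cost is `objective`, which equals `∑ q(cᵢ,
Sᵢ; X)`. Solutions of the problem are exactly the minimisers of `objective` on the open set of
full-rank `X` (`isSolution_iff`). There the gradient vanishes, and it is `2 ∑ s` (`hasFDerivAt_q`),
so every solution solves the estimating equation. What remains for (a) is that a solution exists
with probability tending to one.

Existence holds once `objective` outside some closed ball around `X₀` is at least its value at `X₀`
(`exists_isSolution`). Put `L = deviation J X₀ X` and `Wᵢ = Z_J (Z_Jᵀ Σᵢ Z_J)⁻¹ Z_Jᵀ`. Then
`objective` is the sum of the forms `Wᵢ` at `Lᵀ a₀ᵢ + c̃ᵢ`. The signal part is at least a multiple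
of `λ_min(A₀ᵀA₀) ‖L‖²`, and `‖L‖` is bounded below off the ball, even as `X → ∞`
(`exists_deviation_lower_bound`). The noise part has mean `m σ² d` for every fixed `X`, because
`tr(Wᵢ Σᵢ) = d`, so its mean cancels in the difference. The centred noise and the cross term must be
small against `λ_min`, uniformly in `X` (`objective_sub_ge`).

This uniformity is the crux (`exists_uniform_bound`). The entries of `Wᵢ` are bounded independently
of `Z`, and `Wᵢ = W - W (Σᵢ - Σ) Wᵢ` for the weight `W` of a reference matrix `Σ`. Iterating this
expands `∑ ξᵢ Wᵢ` into sums of `ξᵢ` times monomials in the entries of `Σᵢ - Σ`, which do not involve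
`Z`, with coefficients bounded uniformly in `Z`. As the `Σᵢ` are bounded, finitely many references
make the series geometric. Hence the expected bound has the order of one sum, `√(∑ E ξᵢ²)`; this is
`o(λ_min)` by (vi) for the quadratic noise and by (vii) for the cross term.

For (b), `Z(X₀)ᵀ cᵢ` is pure noise, and the correction in `s` is the regression of `aᵢ` on it, so
the second moments cancel (`integral_s_eq_zero`). -/

namespace EWTLS

set_option linter.unusedSectionVars false

/-! ### Linear algebra of the weight `Z (Zᵀ S Z)⁻¹ Zᵀ`. -/

section LinearAlgebra

open Matrix

variable {ι p : Type*} [Fintype ι] [DecidableEq ι] [Fintype p] [DecidableEq p]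

/-- Subtracting `lambdaMin M` shifts the spectrum into the nonnegative half-line. The spectrum is
finite, so `sInf` is a genuine lower bound. -/
lemma lambdaMin_mul_le {M : Matrix ι ι ℝ} (hM : M.IsHermitian) (x : ι → ℝ) :
    lambdaMin M * (x ⬝ᵥ x) ≤ x ⬝ᵥ (M *ᵥ x) := by
  have hps : (M - lambdaMin M • (1 : Matrix ι ι ℝ)).PosSemidef := by
    rw [posSemidef_iff_isHermitian_and_spectrum_nonneg]
    refine ⟨hM.sub ?_, fun y hy => ?_⟩
    · simp [Matrix.IsHermitian]
    · have h1 : y + lambdaMin M ∈ spectrum ℝ M := by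
        rw [← Algebra.algebraMap_eq_smul_one, ← spectrum.sub_singleton_eq] at hy
        obtain ⟨z, hz, rfl⟩ := by simpa [Set.mem_sub] using hy
        simpa using hz
      have h2 : lambdaMin M ≤ y + lambdaMin M :=
        csInf_le (Matrix.finite_real_spectrum).bddBelow h1
      simpa using h2
  have := hps.dotProduct_mulVec_nonneg x
  simp only [star_trivial, sub_mulVec, smul_mulVec, one_mulVec, dotProduct_sub,
    dotProduct_smul, smul_eq_mul] at this
  linarith

lemma diag_le_lambdaMax {M : Matrix ι ι ℝ} (hM : M.IsHermitian) (k : ι) :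
    M k k ≤ lambdaMax M := by
  have hps : (lambdaMax M • (1 : Matrix ι ι ℝ) - M).PosSemidef := by
    rw [posSemidef_iff_isHermitian_and_spectrum_nonneg]
    refine ⟨Matrix.IsHermitian.sub ?_ hM, fun y hy => ?_⟩
    · simp [Matrix.IsHermitian]
    · have h1 : lambdaMax M - y ∈ spectrum ℝ M := by
        rw [← Algebra.algebraMap_eq_smul_one, ← spectrum.singleton_sub_eq] at hy
        obtain ⟨z, hz, rfl⟩ := by simpa [Set.mem_sub] using hy
        simpa using hz
      have h2 : lambdaMax M - y ≤ lambdaMax M :=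
        le_csSup (Matrix.finite_real_spectrum).bddAbove h1
      simpa using h2
  have := hps.diag_nonneg (i := k)
  simp at this
  linarith

lemma mulVec_injective_of_rank_eq {Z : Matrix ι p ℝ} (hZ : Z.rank = Fintype.card p) :
    Function.Injective Z.mulVec := by
  have h := Z.mulVecLin.finrank_range_add_finrank_ker
  rw [← Matrix.rank, hZ, Module.finrank_fintype_fun_eq_card] at h
  have h0 : Module.finrank ℝ (LinearMap.ker Z.mulVecLin) = 0 := by omega
  exact LinearMap.ker_eq_bot.mp (Submodule.finrank_eq_zero.mp h0)

lemma posDef_gram {Z : Matrix ι p ℝ} (hZ : Z.rank = Fintype.card p) {S : Matrix ι ι ℝ}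
    (hS : S.PosDef) : (Zᵀ * S * Z).PosDef := by
  simpa using hS.conjTranspose_mul_mul_same (mulVec_injective_of_rank_eq hZ)

lemma isUnit_det_gram {Z : Matrix ι p ℝ} (hZ : Z.rank = Fintype.card p) {S : Matrix ι ι ℝ}
    (hS : S.PosDef) : IsUnit (Zᵀ * S * Z).det :=
  (posDef_gram hZ hS).det_pos.ne'.isUnit

lemma rank_eq_card_iff {Z : Matrix ι p ℝ} :
    Z.rank = Fintype.card p ↔ (Zᵀ * Z).det ≠ 0 := by
  constructor
  · intro h
    simpa using (isUnit_det_gram h (S := 1) PosDef.one).ne_zero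
  · intro h
    rw [← rank_transpose_mul_self, rank_of_det_ne_zero h]

/-- The weight matrix `Z (Zᵀ S Z)⁻¹ Zᵀ` of the quadratic form `q`. -/
noncomputable def wproj (Z : Matrix ι p ℝ) (S : Matrix ι ι ℝ) : Matrix ι ι ℝ :=
  Z * (Zᵀ * S * Z)⁻¹ * Zᵀ

lemma wproj_transpose (Z : Matrix ι p ℝ) {S : Matrix ι ι ℝ} (hS : Sᵀ = S) :
    (wproj Z S)ᵀ = wproj Z S := by
  simp only [wproj, transpose_mul, transpose_nonsing_inv, transpose_transpose, hS, Matrix.mul_assoc]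

lemma wproj_mul_mul_right {Z : Matrix ι p ℝ} (S₁ : Matrix ι ι ℝ) {S₂ : Matrix ι ι ℝ}
    (h : IsUnit (Zᵀ * S₂ * Z).det) : wproj Z S₁ * S₂ * wproj Z S₂ = wproj Z S₁ := by
  have : wproj Z S₁ * S₂ * wproj Z S₂ =
      Z * (Zᵀ * S₁ * Z)⁻¹ * ((Zᵀ * S₂ * Z) * (Zᵀ * S₂ * Z)⁻¹) * Zᵀ := by
    simp only [wproj, Matrix.mul_assoc]
  rw [this, Matrix.mul_nonsing_inv _ h, Matrix.mul_one, wproj]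

lemma wproj_mul_mul_left {Z : Matrix ι p ℝ} {S₁ : Matrix ι ι ℝ} (S₂ : Matrix ι ι ℝ)
    (h : IsUnit (Zᵀ * S₁ * Z).det) : wproj Z S₁ * S₁ * wproj Z S₂ = wproj Z S₂ := by
  have : wproj Z S₁ * S₁ * wproj Z S₂ =
      Z * ((Zᵀ * S₁ * Z)⁻¹ * (Zᵀ * S₁ * Z)) * (Zᵀ * S₂ * Z)⁻¹ * Zᵀ := by
    simp only [wproj, Matrix.mul_assoc]
  rw [this, Matrix.nonsing_inv_mul _ h, Matrix.mul_one, wproj]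

lemma wproj_mul_mul_self {Z : Matrix ι p ℝ} {S : Matrix ι ι ℝ}
    (h : IsUnit (Zᵀ * S * Z).det) : wproj Z S * S * Z = Z := by
  have : wproj Z S * S * Z = Z * ((Zᵀ * S * Z)⁻¹ * (Zᵀ * S * Z)) := by
    simp only [wproj, Matrix.mul_assoc]
  rw [this, Matrix.nonsing_inv_mul _ h, Matrix.mul_one]

/-- Resolvent identity: it changes `S` while keeping `Z`, at a cost linear in `S₂ - S₁`. -/
lemma wproj_eq_sub {Z : Matrix ι p ℝ} {S₁ S₂ : Matrix ι ι ℝ}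
    (h₁ : IsUnit (Zᵀ * S₁ * Z).det) (h₂ : IsUnit (Zᵀ * S₂ * Z).det) :
    wproj Z S₂ = wproj Z S₁ - wproj Z S₁ * ((S₂ - S₁) * wproj Z S₂) := by
  rw [Matrix.sub_mul, Matrix.mul_sub, ← Matrix.mul_assoc, ← Matrix.mul_assoc,
    wproj_mul_mul_right _ h₂, wproj_mul_mul_left _ h₁]
  abel

/-- Cyclicity of the trace turns the product into an identity of size `p`. Since the value ignores
`Z`, the mean of the noise form does not depend on the parameter. -/
lemma trace_wproj_mul {Z : Matrix ι p ℝ} {S : Matrix ι ι ℝ}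
    (h : IsUnit (Zᵀ * S * Z).det) : (wproj Z S * S).trace = Fintype.card p := by
  rw [wproj, Matrix.mul_assoc, Matrix.mul_assoc, Matrix.trace_mul_comm, Matrix.mul_assoc,
    Matrix.nonsing_inv_mul _ h, Matrix.trace_one]

/-- A column `w` of `W = wproj Z S` satisfies `wᵀ S w = w b`, as `W S W = W`. Hence `k |w|² ≤ w b`,
which forces `w b ≤ k⁻¹` and then `|w| ≤ k⁻¹`. No compactness in `Z` is needed. -/
lemma abs_wproj_le {Z : Matrix ι p ℝ} {S : Matrix ι ι ℝ} (hS : Sᵀ = S)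
    (h : IsUnit (Zᵀ * S * Z).det) {k : ℝ} (hk : 0 < k)
    (hlow : ∀ x : ι → ℝ, k * (x ⬝ᵥ x) ≤ x ⬝ᵥ (S *ᵥ x)) (a b : ι) :
    |wproj Z S a b| ≤ k⁻¹ := by
  set w : ι → ℝ := fun i => wproj Z S i b with hw
  have hbb : wproj Z S b b = w ⬝ᵥ (S *ᵥ w) := by
    have h1 := congrFun (congrFun (wproj_mul_mul_right S h) b) b
    rw [← h1, Matrix.mul_assoc, Matrix.mul_apply]
    refine Finset.sum_congr rfl fun i _ => ?_
    have : wproj Z S b i = w i := by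
      conv_lhs => rw [← wproj_transpose Z hS]
      rfl
    rw [this]
    rfl
  have hsum : k * (w ⬝ᵥ w) ≤ w b := by
    calc k * (w ⬝ᵥ w) ≤ w ⬝ᵥ (S *ᵥ w) := hlow w
      _ = w b := hbb.symm
  have hsq : ∀ i, w i ^ 2 ≤ w ⬝ᵥ w := fun i => by
    rw [sq]
    exact Finset.single_le_sum (f := fun i => w i * w i) (fun i _ => mul_self_nonneg _)
      (Finset.mem_univ i)
  have hb : w b ≤ k⁻¹ := by
    have h1 : k * w b ^ 2 ≤ w b := (mul_le_mul_of_nonneg_left (hsq b) hk.le).trans hsum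
    rw [← one_div, le_div_iff₀ hk]
    by_contra! h2
    have : 0 < w b := by
      by_contra! h3
      nlinarith
    nlinarith
  have h1 : (k * w a) ^ 2 ≤ 1 := by
    have h2 : k * (w a) ^ 2 ≤ k⁻¹ :=
      ((mul_le_mul_of_nonneg_left (hsq a) hk.le).trans hsum).trans hb
    calc (k * w a) ^ 2 = k * (k * (w a) ^ 2) := by ring
      _ ≤ k * k⁻¹ := mul_le_mul_of_nonneg_left h2 hk.le
      _ = 1 := mul_inv_cancel₀ hk.ne'
  have h2 := (sq_le_one_iff_abs_le_one _).mp h1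
  rw [abs_mul, abs_of_pos hk] at h2
  rw [← one_div, le_div_iff₀ hk, mul_comm]
  exact h2

/-- On the range of `Z`, `W S y = y`. Expanding `0 ≤ (w - K⁻¹ y)ᵀ S (w - K⁻¹ y)` for `w = W y` gives
the bound. -/
lemma le_dotProduct_wproj {Z : Matrix ι p ℝ} {S : Matrix ι ι ℝ} (hS : Sᵀ = S)
    (h : IsUnit (Zᵀ * S * Z).det) (hpos : ∀ x : ι → ℝ, 0 ≤ x ⬝ᵥ (S *ᵥ x)) {K : ℝ} (hK : 0 < K)
    (hup : ∀ x : ι → ℝ, x ⬝ᵥ (S *ᵥ x) ≤ K * (x ⬝ᵥ x)) (u : p → ℝ) :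
    K⁻¹ * ((Z *ᵥ u) ⬝ᵥ (Z *ᵥ u)) ≤ (Z *ᵥ u) ⬝ᵥ (wproj Z S *ᵥ (Z *ᵥ u)) := by
  set y := Z *ᵥ u with hy
  set w := wproj Z S *ᵥ y with hw
  have h1 : wproj Z S *ᵥ (S *ᵥ y) = y := by
    rw [hy, mulVec_mulVec, mulVec_mulVec, wproj_mul_mul_self h]
  have h2 : ∀ x, w ⬝ᵥ x = y ⬝ᵥ (wproj Z S *ᵥ x) := fun x => by
    rw [dotProduct_mulVec, ← mulVec_transpose, wproj_transpose Z hS]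
  have hwSy : w ⬝ᵥ (S *ᵥ y) = y ⬝ᵥ y := by rw [h2, h1]
  have hySw : y ⬝ᵥ (S *ᵥ w) = y ⬝ᵥ y := by
    rw [dotProduct_mulVec, ← mulVec_transpose, hS, dotProduct_comm, hwSy]
  have hwSw : w ⬝ᵥ (S *ᵥ w) = y ⬝ᵥ w := by
    rw [h2, hw, mulVec_mulVec, mulVec_mulVec, wproj_mul_mul_right _ h]
  have h3 := hpos (w - K⁻¹ • y)
  simp only [mulVec_sub, mulVec_smul, sub_dotProduct, dotProduct_sub, smul_dotProduct,
    dotProduct_smul, smul_eq_mul, hwSy, hySw, hwSw] at h3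
  have h4 : K⁻¹ * (K⁻¹ * (y ⬝ᵥ (S *ᵥ y))) ≤ K⁻¹ * (y ⬝ᵥ y) := by
    have := hup y
    have hKi : 0 < K⁻¹ := inv_pos.mpr hK
    calc K⁻¹ * (K⁻¹ * (y ⬝ᵥ (S *ᵥ y))) ≤ K⁻¹ * (K⁻¹ * (K * (y ⬝ᵥ y))) := by gcongr
      _ = K⁻¹ * (y ⬝ᵥ y) := by field_simp
  nlinarith

section

open scoped MatrixOrder

lemma norm_sq_inv_sqrt_mulVec {S : Matrix ι ι ℝ} (hS : S.PosDef) (v : ι → ℝ) :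
    ‖WithLp.toLp 2 ((CFC.sqrt S)⁻¹ *ᵥ v)‖ ^ 2 = v ⬝ᵥ (S⁻¹ *ᵥ v) := by
  have hsq : CFC.sqrt S * CFC.sqrt S = S :=
    CFC.sqrt_mul_sqrt_self S (Matrix.nonneg_iff_posSemidef.mpr hS.posSemidef)
  have hsymm : (CFC.sqrt S)ᵀ = CFC.sqrt S := by
    have := (Matrix.nonneg_iff_posSemidef.mp (CFC.sqrt_nonneg S)).isHermitian
    simpa [Matrix.IsHermitian] using this
  rw [EuclideanSpace.norm_sq_eq]
  have h1 : ∑ i, ‖(WithLp.toLp 2 ((CFC.sqrt S)⁻¹ *ᵥ v)) i‖ ^ 2 =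
      ((CFC.sqrt S)⁻¹ *ᵥ v) ⬝ᵥ ((CFC.sqrt S)⁻¹ *ᵥ v) := by
    simp [dotProduct, sq]
  rw [h1, dotProduct_mulVec, ← mulVec_transpose, transpose_nonsing_inv, hsymm, mulVec_mulVec,
    ← Matrix.mul_inv_rev, hsq, dotProduct_comm]

end

/-- With `w = W v`, the difference of the two sides is the `S⁻¹`-form of the residual `v - S w`. -/
lemma dotProduct_inv_gram_le {Z : Matrix ι p ℝ} (hZ : Z.rank = Fintype.card p)
    {S : Matrix ι ι ℝ} (hS : S.PosDef) (v : ι → ℝ) :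
    (Zᵀ *ᵥ v) ⬝ᵥ ((Zᵀ * S * Z)⁻¹ *ᵥ (Zᵀ *ᵥ v)) ≤ v ⬝ᵥ (S⁻¹ *ᵥ v) := by
  have hu := isUnit_det_gram hZ hS
  have hSu : IsUnit S.det := hS.det_pos.ne'.isUnit
  have hSt : Sᵀ = S := by simpa [Matrix.IsHermitian] using hS.isHermitian
  set w := wproj Z S *ᵥ v with hw
  have h2 : (Zᵀ *ᵥ v) ⬝ᵥ ((Zᵀ * S * Z)⁻¹ *ᵥ (Zᵀ *ᵥ v)) = v ⬝ᵥ w := by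
    rw [hw, wproj, ← mulVec_mulVec, ← mulVec_mulVec, dotProduct_mulVec v, ← mulVec_transpose]
  have hwSw : w ⬝ᵥ (S *ᵥ w) = v ⬝ᵥ w := by
    rw [hw, dotProduct_comm, dotProduct_mulVec, ← mulVec_transpose, wproj_transpose Z hSt,
      mulVec_mulVec, mulVec_mulVec, wproj_mul_mul_right _ hu, dotProduct_comm]
  have h3 := (hS.inv.posSemidef).dotProduct_mulVec_nonneg (v - S *ᵥ w)
  have h4 : S⁻¹ *ᵥ (S *ᵥ w) = w := by
    rw [mulVec_mulVec, Matrix.nonsing_inv_mul _ hSu, one_mulVec]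
  have h5 : (S *ᵥ w) ⬝ᵥ (S⁻¹ *ᵥ v) = v ⬝ᵥ w := by
    rw [dotProduct_mulVec, ← mulVec_transpose, transpose_nonsing_inv, hSt, h4, dotProduct_comm]
  simp only [star_trivial, mulVec_sub, sub_dotProduct, dotProduct_sub, h4, h5] at h3
  rw [h2]
  rw [dotProduct_comm (S *ᵥ w), hwSw] at h3
  linarith

/-- The Lagrange solution `S Z (Zᵀ S Z)⁻¹ t` attains the lower bound of `dotProduct_inv_gram_le`. -/
lemma exists_dotProduct_inv_eq {Z : Matrix ι p ℝ} (hZ : Z.rank = Fintype.card p)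
    {S : Matrix ι ι ℝ} (hS : S.PosDef) (t : p → ℝ) :
    ∃ v : ι → ℝ, Zᵀ *ᵥ v = t ∧ v ⬝ᵥ (S⁻¹ *ᵥ v) = t ⬝ᵥ ((Zᵀ * S * Z)⁻¹ *ᵥ t) := by
  have hu := isUnit_det_gram hZ hS
  have hSu : IsUnit S.det := hS.det_pos.ne'.isUnit
  have h1 : Zᵀ *ᵥ (S *ᵥ (Z *ᵥ ((Zᵀ * S * Z)⁻¹ *ᵥ t))) = t := by
    rw [mulVec_mulVec, mulVec_mulVec, mulVec_mulVec,
      Matrix.mul_nonsing_inv _ hu, one_mulVec]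
  refine ⟨S *ᵥ (Z *ᵥ ((Zᵀ * S * Z)⁻¹ *ᵥ t)), h1, ?_⟩
  rw [mulVec_mulVec _ S⁻¹ S, Matrix.nonsing_inv_mul _ hSu, one_mulVec, dotProduct_mulVec,
    ← mulVec_transpose, h1]

end LinearAlgebra

/-! ### Iterated resolvent expansion. -/

section Chain

open Matrix

variable {α ι : Type*} [Fintype ι] [DecidableEq ι]

/-- Sum over all words of length `k` in the entries of `D` of the absolute values of the sums of
`x` weighted by the corresponding monomials. -/
noncomputable def chainSum (s : Finset α) (D : α → Matrix ι ι ℝ) : ℕ → (α → ℝ) → ℝ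
  | 0, x => |∑ i ∈ s, x i|
  | k + 1, x => ∑ a, ∑ b, chainSum s D k (fun i => x i * D i a b)

lemma chainSum_nonneg (s : Finset α) (D : α → Matrix ι ι ℝ) (k : ℕ) (x : α → ℝ) :
    0 ≤ chainSum s D k x := by
  induction k generalizing x with
  | zero => exact abs_nonneg _
  | succ k ih => exact Finset.sum_nonneg fun a _ => Finset.sum_nonneg fun b _ => ih _

/-- Each substitution of `hres` pulls the constant `W₀` out of the sum and attaches one letter `D i
p q` to `x i`. After `k` substitutions the remainder is estimated trivially: there are `card ι ^ 2`
letters, each at most `δ`. -/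
lemma abs_sum_mul_le_chainSum {s : Finset α} {D W : α → Matrix ι ι ℝ} {W₀ : Matrix ι ι ℝ}
    {ρ δ : ℝ} (hρ : 0 ≤ ρ) (hW₀ : ∀ a b, |W₀ a b| ≤ ρ) (hW : ∀ i ∈ s, ∀ a b, |W i a b| ≤ ρ)
    (hD : ∀ i ∈ s, ∀ a b, |D i a b| ≤ δ) (hδ : 0 ≤ δ)
    (hres : ∀ i ∈ s, W i = W₀ - W₀ * (D i * W i)) (k : ℕ) (x : α → ℝ) (a b : ι) :
    |∑ i ∈ s, x i * W i a b| ≤ ∑ j ∈ Finset.range k, ρ ^ (j + 1) * chainSum s D j x +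
      ρ ^ (k + 1) * ((Fintype.card ι : ℝ) ^ 2 * δ) ^ k * ∑ i ∈ s, |x i| := by
  induction k generalizing x a b with
  | zero =>
    simp only [Finset.range_zero, Finset.sum_empty, zero_add, pow_one, pow_zero, mul_one,
      Finset.mul_sum]
    refine (Finset.abs_sum_le_sum_abs _ _).trans (Finset.sum_le_sum fun i hi => ?_)
    rw [abs_mul, mul_comm]
    exact mul_le_mul_of_nonneg_right (hW i hi a b) (abs_nonneg _)
  | succ k ih =>
    have hexp : ∑ i ∈ s, x i * W i a b = W₀ a b * ∑ i ∈ s, x i -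
        ∑ p, ∑ q, W₀ a p * ∑ i ∈ s, (x i * D i p q) * W i q b := by
      have h1 : ∀ i ∈ s, x i * W i a b =
          W₀ a b * x i - ∑ p, ∑ q, W₀ a p * ((x i * D i p q) * W i q b) := fun i hi => by
        have h2 : W i a b = W₀ a b - ∑ p, W₀ a p * ∑ q, D i p q * W i q b := by
          conv_lhs => rw [hres i hi]
          simp [Matrix.mul_apply]
        rw [h2, mul_sub, mul_comm (x i), Finset.mul_sum]
        congr 1
        refine Finset.sum_congr rfl fun p _ => ?_
        rw [Finset.mul_sum, Finset.mul_sum]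
        exact Finset.sum_congr rfl fun q _ => by ring
      rw [Finset.sum_congr rfl h1, Finset.sum_sub_distrib, Finset.mul_sum, Finset.sum_comm]
      congr 1
      refine Finset.sum_congr rfl fun p _ => ?_
      rw [Finset.sum_comm]
      exact Finset.sum_congr rfl fun q _ => by rw [Finset.mul_sum]
    have hpq : ∀ p q, |W₀ a p * ∑ i ∈ s, (x i * D i p q) * W i q b| ≤
        ∑ j ∈ Finset.range k, ρ ^ (j + 2) * chainSum s D j (fun i => x i * D i p q) +
          ρ ^ (k + 2) * ((Fintype.card ι : ℝ) ^ 2 * δ) ^ k * (δ * ∑ i ∈ s, |x i|) := fun p q => by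
      rw [abs_mul]
      have h1 : ∑ i ∈ s, |x i * D i p q| ≤ δ * ∑ i ∈ s, |x i| := by
        rw [Finset.mul_sum]
        refine Finset.sum_le_sum fun i hi => ?_
        rw [abs_mul, mul_comm]
        exact mul_le_mul_of_nonneg_right (hD i hi p q) (abs_nonneg _)
      calc |W₀ a p| * |∑ i ∈ s, (x i * D i p q) * W i q b|
          ≤ ρ * (∑ j ∈ Finset.range k, ρ ^ (j + 1) * chainSum s D j (fun i => x i * D i p q) +
            ρ ^ (k + 1) * ((Fintype.card ι : ℝ) ^ 2 * δ) ^ k * ∑ i ∈ s, |x i * D i p q|) :=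
            mul_le_mul (hW₀ a p) (ih _ q b) (abs_nonneg _) hρ
        _ ≤ ρ * (∑ j ∈ Finset.range k, ρ ^ (j + 1) * chainSum s D j (fun i => x i * D i p q) +
            ρ ^ (k + 1) * ((Fintype.card ι : ℝ) ^ 2 * δ) ^ k * (δ * ∑ i ∈ s, |x i|)) := by
            gcongr
        _ = _ := by
            rw [mul_add, Finset.mul_sum]
            congr 1
            · exact Finset.sum_congr rfl fun j _ => by ring
            · ring
    rw [hexp]
    calc |W₀ a b * ∑ i ∈ s, x i - ∑ p, ∑ q, W₀ a p * ∑ i ∈ s, (x i * D i p q) * W i q b|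
        ≤ |W₀ a b * ∑ i ∈ s, x i| + |∑ p, ∑ q, W₀ a p * ∑ i ∈ s, (x i * D i p q) * W i q b| :=
          abs_sub _ _
      _ ≤ ρ * chainSum s D 0 x + ∑ p : ι, ∑ q : ι,
          (∑ j ∈ Finset.range k, ρ ^ (j + 2) * chainSum s D j (fun i => x i * D i p q) +
          ρ ^ (k + 2) * ((Fintype.card ι : ℝ) ^ 2 * δ) ^ k * (δ * ∑ i ∈ s, |x i|)) := by
          refine add_le_add ?_ ?_
          · rw [abs_mul]
            exact mul_le_mul_of_nonneg_right (hW₀ a b) (abs_nonneg _)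
          · refine (Finset.abs_sum_le_sum_abs _ _).trans (Finset.sum_le_sum fun p _ => ?_)
            exact (Finset.abs_sum_le_sum_abs _ _).trans (Finset.sum_le_sum fun q _ => hpq p q)
      _ = _ := by
          simp only [Finset.sum_add_distrib, Finset.sum_const, Finset.card_univ, nsmul_eq_mul]
          rw [Finset.sum_range_succ' (fun j => ρ ^ (j + 1) * chainSum s D j x)]
          have h1 : ∑ p : ι, ∑ q : ι, ∑ j ∈ Finset.range k,
              ρ ^ (j + 2) * chainSum s D j (fun i => x i * D i p q) =
              ∑ j ∈ Finset.range k, ρ ^ (j + 1 + 1) * chainSum s D (j + 1) x := by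
            simp only [chainSum, Finset.mul_sum]
            exact Eq.trans (Finset.sum_congr rfl fun p _ => Finset.sum_comm) Finset.sum_comm
          rw [h1]
          ring

/-- As `k → ∞` the remainder vanishes geometrically. The bound left over contains neither `W` nor
`W₀`, so it is uniform in them. -/
lemma ofReal_abs_sum_mul_le_tsum {s : Finset α} {D W : α → Matrix ι ι ℝ} {W₀ : Matrix ι ι ℝ}
    {ρ δ : ℝ} (hρ : 0 ≤ ρ) (hW₀ : ∀ a b, |W₀ a b| ≤ ρ) (hW : ∀ i ∈ s, ∀ a b, |W i a b| ≤ ρ)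
    (hD : ∀ i ∈ s, ∀ a b, |D i a b| ≤ δ) (hδ : 0 ≤ δ)
    (hres : ∀ i ∈ s, W i = W₀ - W₀ * (D i * W i))
    (hsmall : ρ * ((Fintype.card ι : ℝ) ^ 2 * δ) < 1) (x : α → ℝ) (a b : ι) :
    ENNReal.ofReal |∑ i ∈ s, x i * W i a b| ≤
      ∑' j, ENNReal.ofReal (ρ ^ (j + 1) * chainSum s D j x) := by
  set T := ∑' j, ENNReal.ofReal (ρ ^ (j + 1) * chainSum s D j x)
  have hk : ∀ k, ENNReal.ofReal |∑ i ∈ s, x i * W i a b| ≤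
      T + ENNReal.ofReal (ρ * (∑ i ∈ s, |x i|) *
        (ρ * ((Fintype.card ι : ℝ) ^ 2 * δ)) ^ k) := fun k => by
    refine (ENNReal.ofReal_le_ofReal
      (abs_sum_mul_le_chainSum hρ hW₀ hW hD hδ hres k x a b)).trans ?_
    refine ENNReal.ofReal_add_le.trans (add_le_add ?_ (le_of_eq (congrArg _ ?_)))
    · rw [ENNReal.ofReal_sum_of_nonneg fun j _ =>
        mul_nonneg (pow_nonneg hρ _) (chainSum_nonneg _ _ _ _)]
      exact ENNReal.sum_le_tsum _
    · rw [mul_pow, pow_succ]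
      ring
  have hlim : Tendsto (fun k : ℕ => T + ENNReal.ofReal (ρ * (∑ i ∈ s, |x i|) *
        (ρ * ((Fintype.card ι : ℝ) ^ 2 * δ)) ^ k)) atTop (𝓝 (T + 0)) := by
    refine Tendsto.add tendsto_const_nhds ?_
    have h1 := (tendsto_pow_atTop_nhds_zero_of_lt_one (by positivity) hsmall).const_mul
      (ρ * (∑ i ∈ s, |x i|))
    simpa [Function.comp_def] using (ENNReal.continuous_ofReal.tendsto _).comp h1
  rw [add_zero] at hlim
  exact ge_of_tendsto' hlim hk

end Chain

/-! ### Moment bounds, uniform over all full-rank `Z`. -/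

section Moments

open Matrix

variable {α ι Ω : Type*} [Fintype ι] [DecidableEq ι] [MeasurableSpace Ω] {μ : Measure Ω}
  [IsProbabilityMeasure μ]

lemma measurable_chainSum (s : Finset α) (D : α → Matrix ι ι ℝ) (k : ℕ) {x : Ω → α → ℝ}
    (hx : ∀ i, Measurable fun ω => x ω i) : Measurable fun ω => chainSum s D k (x ω) := by
  induction k generalizing x with
  | zero => exact (Finset.measurable_sum s fun i _ => hx i).abs
  | succ k ih =>
    exact Finset.measurable_sum _ fun a _ => Finset.measurable_sum _ fun b _ =>
      ih fun i => (hx i).mul_const _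

/-- The first moment is at most the root of the second, and pairwise independence makes the
variances add. -/
lemma lintegral_abs_sum_le {ξ : α → Ω → ℝ} (s : Finset α)
    (hL2 : ∀ i, MemLp (ξ i) 2 μ) (hmean : ∀ i, ∫ ω, ξ i ω ∂μ = 0)
    (hind : Pairwise fun i j => IndepFun (ξ i) (ξ j) μ) {c : α → ℝ} {A : ℝ} (hA : 0 ≤ A)
    (hc : ∀ i ∈ s, |c i| ≤ A) :
    ∫⁻ ω, ENNReal.ofReal |∑ i ∈ s, ξ i ω * c i| ∂μ ≤
      ENNReal.ofReal (A * √(∑ i ∈ s, ∫ ω, ξ i ω ^ 2 ∂μ)) := by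
  set X : α → Ω → ℝ := fun i ω => ξ i ω * c i with hX
  set f : Ω → ℝ := ∑ i ∈ s, X i with hf
  have hXL2 : ∀ i, MemLp (X i) 2 μ := fun i => by
    simpa [hX, mul_comm] using (hL2 i).const_mul (c i)
  have hfL2 : MemLp f 2 μ := memLp_finsetSum' s fun i _ => hXL2 i
  have hfeq : ∀ ω, f ω = ∑ i ∈ s, ξ i ω * c i := fun ω => by simp [hf, hX]
  have hXmean : ∀ i, ∫ ω, X i ω ∂μ = 0 := fun i => by
    simp [hX, integral_mul_const, hmean]
  have hfmean : ∫ ω, f ω ∂μ = 0 := by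
    simp only [hf, Finset.sum_apply]
    rw [integral_finsetSum _ fun i _ => (hXL2 i).integrable (by norm_num)]
    exact Finset.sum_eq_zero fun i _ => hXmean i
  have hvar : ∫ ω, f ω ^ 2 ∂μ ≤ A ^ 2 * ∑ i ∈ s, ∫ ω, ξ i ω ^ 2 ∂μ := by
    have h1 : Var[f; μ] = ∑ i ∈ s, Var[X i; μ] :=
      IndepFun.variance_sum (fun i _ => hXL2 i) fun i _ j _ hij =>
        (hind hij).comp (measurable_id.mul_const (c i)) (measurable_id.mul_const (c j))
    rw [variance_of_integral_eq_zero hfL2.aemeasurable hfmean] at h1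
    rw [h1, Finset.mul_sum]
    refine Finset.sum_le_sum fun i hi => ?_
    rw [variance_of_integral_eq_zero (hXL2 i).aemeasurable (hXmean i)]
    simp only [hX, mul_pow]
    rw [integral_mul_const, mul_comm]
    refine mul_le_mul_of_nonneg_right ?_ (integral_nonneg fun ω => sq_nonneg _)
    rw [← sq_abs]
    exact pow_le_pow_left₀ (abs_nonneg _) (hc i hi) 2
  have habs : ∫ ω, |f ω| ∂μ ≤ A * √(∑ i ∈ s, ∫ ω, ξ i ω ^ 2 ∂μ) := by
    have h1 : (∫ ω, |f ω| ∂μ) ^ 2 ≤ ∫ ω, f ω ^ 2 ∂μ := by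
      have h2 := variance_nonneg (fun ω => |f ω|) μ
      rw [variance_eq_sub (X := fun ω => |f ω|) hfL2.abs] at h2
      simpa using h2
    refine (Real.le_sqrt_of_sq_le (h1.trans hvar)).trans ?_
    rw [Real.sqrt_mul (sq_nonneg _), Real.sqrt_sq hA]
  rw [← ofReal_integral_eq_lintegral_ofReal]
  · refine ENNReal.ofReal_le_ofReal ?_
    simpa only [hfeq] using habs
  · simpa only [hfeq] using (hfL2.integrable (by norm_num)).abs
  · exact ae_of_all _ fun ω => abs_nonneg _

/-- The deterministic factor `c` absorbs the letters of a word: `card ι ^ 2` choices, each costing a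
factor `δ`. -/
lemma lintegral_chainSum_le {ξ : α → Ω → ℝ} (s : Finset α) (hmeas : ∀ i, Measurable (ξ i))
    (hL2 : ∀ i, MemLp (ξ i) 2 μ) (hmean : ∀ i, ∫ ω, ξ i ω ∂μ = 0)
    (hind : Pairwise fun i j => IndepFun (ξ i) (ξ j) μ) {D : α → Matrix ι ι ℝ} {δ : ℝ}
    (hδ : 0 ≤ δ) (hD : ∀ i ∈ s, ∀ a b, |D i a b| ≤ δ) (k : ℕ) {c : α → ℝ} {A : ℝ} (hA : 0 ≤ A)
    (hc : ∀ i ∈ s, |c i| ≤ A) :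
    ∫⁻ ω, ENNReal.ofReal (chainSum s D k fun i => ξ i ω * c i) ∂μ ≤
      ENNReal.ofReal (((Fintype.card ι : ℝ) ^ 2 * δ) ^ k *
        (A * √(∑ i ∈ s, ∫ ω, ξ i ω ^ 2 ∂μ))) := by
  induction k generalizing c A with
  | zero => simpa [chainSum] using lintegral_abs_sum_le s hL2 hmean hind hA hc
  | succ k ih =>
    have h1 : ∀ ω, ENNReal.ofReal (chainSum s D (k + 1) fun i => ξ i ω * c i) =
        ∑ a, ∑ b, ENNReal.ofReal (chainSum s D k fun i => ξ i ω * (c i * D i a b)) := fun ω => by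
      rw [chainSum, ENNReal.ofReal_sum_of_nonneg fun a _ =>
        Finset.sum_nonneg fun b _ => chainSum_nonneg _ _ _ _]
      refine Finset.sum_congr rfl fun a _ => ?_
      rw [ENNReal.ofReal_sum_of_nonneg fun b _ => chainSum_nonneg _ _ _ _]
      simp only [mul_assoc]
    have hm : ∀ a b, Measurable fun ω =>
        ENNReal.ofReal (chainSum s D k fun i => ξ i ω * (c i * D i a b)) := fun a b =>
      (measurable_chainSum s D k fun i => (hmeas i).mul_const _).ennreal_ofReal
    simp_rw [h1]
    rw [lintegral_finsetSum _ fun a _ => Finset.measurable_sum _ fun b _ => hm a b]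
    simp_rw [lintegral_finsetSum _ fun b _ => hm _ b]
    have h2 : ∀ a b, ∫⁻ ω, ENNReal.ofReal (chainSum s D k fun i => ξ i ω * (c i * D i a b)) ∂μ ≤
        ENNReal.ofReal (((Fintype.card ι : ℝ) ^ 2 * δ) ^ k *
        (A * δ * √(∑ i ∈ s, ∫ ω, ξ i ω ^ 2 ∂μ))) := fun a b =>
      ih (mul_nonneg hA hδ) fun i hi => by
        rw [abs_mul]
        exact mul_le_mul (hc i hi) (hD i hi a b) (abs_nonneg _) hA
    refine (Finset.sum_le_sum fun a _ => Finset.sum_le_sum fun b _ => h2 a b).trans ?_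
    simp only [Finset.sum_const, Finset.card_univ, nsmul_eq_mul]
    rw [← ENNReal.ofReal_natCast, ← ENNReal.ofReal_mul (by positivity),
      ← ENNReal.ofReal_mul (by positivity)]
    refine le_of_eq (congrArg _ ?_)
    rw [pow_succ]
    ring

/-- A bounded family in finite dimension is totally bounded. The centres are members of the family,
so they inherit its positive definiteness and lower bound. -/
lemma exists_finset_approx {Sig : ℕ → Matrix ι ι ℝ} {K : ℝ} (hK : ∀ i a b, |Sig i a b| ≤ K)
    {δ : ℝ} (hδ : 0 < δ) :
    ∃ (T : Finset ℕ) (col : ℕ → ℕ), (∀ i, col i ∈ T) ∧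
      ∀ i a b, |(Sig i - Sig (col i)) a b| ≤ δ := by
  let f : ℕ → ι → ι → ℝ := fun i a b => Sig i a b
  have hb : Bornology.IsBounded (Set.range f) := by
    refine (Metric.isBounded_closedBall (x := (0 : ι → ι → ℝ)) (r := max K 0)).subset ?_
    rintro _ ⟨i, rfl⟩
    rw [Metric.mem_closedBall, dist_pi_le_iff (le_max_right _ _)]
    intro a
    rw [dist_pi_le_iff (le_max_right _ _)]
    intro b
    rw [Real.dist_eq]
    simpa [f] using Or.inl (hK i a b)
  have htb : TotallyBounded (Set.range f) := hb.isCompact_closure.totallyBounded.subset subset_closure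
  obtain ⟨t, htsub, htfin, hcov⟩ := Metric.finite_approx_of_totallyBounded htb δ hδ
  have hex : ∀ y ∈ t, ∃ i, f i = y := fun y hy => htsub hy
  choose! g hg using hex
  have hcov' : ∀ i, ∃ y ∈ t, dist (f i) y < δ := fun i => by
    simpa using hcov ⟨i, rfl⟩
  choose c hct hc using hcov'
  refine ⟨htfin.toFinset.image g, fun i => g (c i), fun i =>
    Finset.mem_image_of_mem _ (htfin.mem_toFinset.mpr (hct i)), fun i a b => ?_⟩
  have h1 : dist (f i a b) (f (g (c i)) a b) ≤ δ := by
    rw [hg _ (hct i)]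
    exact ((dist_le_pi_dist _ _ b).trans (dist_le_pi_dist _ _ a)).trans (hc i).le
  simpa [Real.dist_eq, f] using h1

/-- Uniform control of `∑ ξᵢ Wᵢ(Z)` over all full-rank `Z`, with the rate of a single sum. -/
theorem exists_uniform_bound {Sig : ℕ → Matrix ι ι ℝ} (hpd : ∀ i, (Sig i).PosDef) {k : ℝ}
    (hk : 0 < k) (hlow : ∀ i (x : ι → ℝ), k * (x ⬝ᵥ x) ≤ x ⬝ᵥ (Sig i *ᵥ x)) {K : ℝ}
    (hK : ∀ i a b, |Sig i a b| ≤ K) (p : Type*) [Fintype p] [DecidableEq p] :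
    ∃ C : ℝ, 0 ≤ C ∧ ∀ (m : ℕ) (ξ : ℕ → Ω → ℝ), (∀ i, Measurable (ξ i)) →
      (∀ i, MemLp (ξ i) 2 μ) → (∀ i, ∫ ω, ξ i ω ∂μ = 0) →
      (Pairwise fun i j => IndepFun (ξ i) (ξ j) μ) →
      ∃ Φ : Ω → ENNReal, Measurable Φ ∧
        ∫⁻ ω, Φ ω ∂μ ≤ ENNReal.ofReal (C * √(∑ i ∈ Finset.range m, ∫ ω, ξ i ω ^ 2 ∂μ)) ∧
        ∀ (ω : Ω) (Z : Matrix ι p ℝ), Z.rank = Fintype.card p → ∀ a b,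
          ENNReal.ofReal |∑ i ∈ Finset.range m, ξ i ω * wproj Z (Sig i) a b| ≤ Φ ω := by
  set ρ : ℝ := k⁻¹ with hρdef
  have hρ : 0 < ρ := inv_pos.mpr hk
  set N : ℝ := (Fintype.card ι : ℝ) ^ 2 with hN
  have hN0 : 0 ≤ N := by positivity
  -- Chosen so that the ratio `ρ * (N * δ)` of the series is at most `1 / 2`.
  set δ : ℝ := (2 * (ρ * (N + 1)))⁻¹ with hδdef
  have hδ : 0 < δ := by positivity
  have hsmall : ρ * (N * δ) ≤ 1 / 2 := by
    rw [hδdef, ← mul_assoc, ← div_eq_mul_inv, div_le_div_iff₀ (by positivity) (by norm_num)]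
    nlinarith
  obtain ⟨T, col, hcolT, hcol⟩ := exists_finset_approx hK hδ
  -- One geometric series of ratio `1 / 2`, with first term of order `ρ`, for each cluster.
  refine ⟨T.card * (2 * ρ), by positivity, fun m ξ hmeas hL2 hmean hind => ?_⟩
  let s : ℕ → Finset ℕ := fun t => (Finset.range m).filter fun i => col i = t
  let D : ℕ → ℕ → Matrix ι ι ℝ := fun t i => Sig i - Sig t
  have hD : ∀ t, ∀ i ∈ s t, ∀ a b, |D t i a b| ≤ δ := fun t i hi a b => by
    have : col i = t := (Finset.mem_filter.mp hi).2
    simpa [D, this] using hcol i a b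
  set V : ℝ := ∑ i ∈ Finset.range m, ∫ ω, ξ i ω ^ 2 ∂μ with hV
  have hVs : ∀ t, ∑ i ∈ s t, ∫ ω, ξ i ω ^ 2 ∂μ ≤ V := fun t =>
    Finset.sum_le_sum_of_subset_of_nonneg (Finset.filter_subset _ _)
      fun i _ _ => integral_nonneg fun ω => sq_nonneg _
  let Ψ : ℕ → Ω → ENNReal := fun t ω =>
    ∑' j, ENNReal.ofReal (ρ ^ (j + 1) * chainSum (s t) (D t) j fun i => ξ i ω)
  have hmj : ∀ t j, Measurable fun ω =>
      ENNReal.ofReal (ρ ^ (j + 1) * chainSum (s t) (D t) j fun i => ξ i ω) := fun t j =>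
    ((measurable_chainSum (s t) (D t) j hmeas).const_mul _).ennreal_ofReal
  have hΨm : ∀ t, Measurable (Ψ t) := fun t => Measurable.tsum fun j => hmj t j
  have hΨ : ∀ t, ∫⁻ ω, Ψ t ω ∂μ ≤ ENNReal.ofReal (2 * ρ * √V) := fun t => by
    rw [lintegral_tsum fun j => (hmj t j).aemeasurable]
    have h1 : ∀ j, ∫⁻ ω, ENNReal.ofReal (ρ ^ (j + 1) * chainSum (s t) (D t) j fun i => ξ i ω) ∂μ ≤
        ENNReal.ofReal (ρ * √V * (1 / 2) ^ j) := fun j => by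
      have h2 := lintegral_chainSum_le (s t) hmeas hL2 hmean hind hδ.le (hD t) j
        (c := fun _ => 1) zero_le_one (by simp)
      simp only [mul_one, one_mul] at h2
      simp_rw [ENNReal.ofReal_mul (pow_nonneg hρ.le _)]
      rw [lintegral_const_mul' _ _ ENNReal.ofReal_ne_top]
      refine (mul_le_mul_right h2 _).trans ?_
      rw [← ENNReal.ofReal_mul (pow_nonneg hρ.le _)]
      refine ENNReal.ofReal_le_ofReal ?_
      calc ρ ^ (j + 1) * ((N * δ) ^ j * √(∑ i ∈ s t, ∫ ω, ξ i ω ^ 2 ∂μ))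
          = ρ * √(∑ i ∈ s t, ∫ ω, ξ i ω ^ 2 ∂μ) * (ρ * (N * δ)) ^ j := by
            rw [mul_pow ρ, pow_succ]
            ring
        _ ≤ ρ * √V * (1 / 2) ^ j := by
            gcongr
            exact hVs t
    refine (ENNReal.tsum_le_tsum h1).trans ?_
    rw [← ENNReal.ofReal_tsum_of_nonneg (fun j => by positivity)
      (summable_geometric_two.mul_left _), tsum_mul_left, tsum_geometric_two]
    exact le_of_eq (congrArg _ (by ring))
  refine ⟨fun ω => ∑ t ∈ T, Ψ t ω, Finset.measurable_sum _ fun t _ => hΨm t, ?_, ?_⟩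
  · rw [lintegral_finsetSum _ fun t _ => hΨm t]
    refine (Finset.sum_le_sum fun t _ => hΨ t).trans ?_
    rw [Finset.sum_const, nsmul_eq_mul, ← ENNReal.ofReal_natCast,
      ← ENNReal.ofReal_mul (by positivity)]
    exact le_of_eq (congrArg _ (by ring))
  · intro ω Z hZ a b
    -- The indices are grouped by reference matrix, and each group is expanded around its own `Sig
    -- t`.
    rw [← Finset.sum_fiberwise_of_maps_to (s := Finset.range m) (t := T) (g := col)
      fun i _ => hcolT i]
    refine (ENNReal.ofReal_le_ofReal (Finset.abs_sum_le_sum_abs _ _)).trans ?_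
    rw [ENNReal.ofReal_sum_of_nonneg fun _ _ => abs_nonneg _]
    refine Finset.sum_le_sum fun t _ => ?_
    have hsymm : ∀ i, (Sig i)ᵀ = Sig i := fun i => by
      simpa [Matrix.IsHermitian] using (hpd i).isHermitian
    have hu := fun i => isUnit_det_gram hZ (hpd i)
    exact ofReal_abs_sum_mul_le_tsum (W := fun i => wproj Z (Sig i)) (W₀ := wproj Z (Sig t))
      hρ.le (abs_wproj_le (hsymm t) (hu t) hk (hlow t))
      (fun i _ => abs_wproj_le (hsymm i) (hu i) hk (hlow i)) (hD t) hδ.le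
      (fun i _ => wproj_eq_sub (hu t) (hu i)) (hsmall.trans_lt (by norm_num)) _ a b

end Moments

/-! ### The gradient of `q`. -/

section Gradient

open Matrix

variable {n d : ℕ}

lemma Zmat_mulVec (X : Matrix (Fin n) (Fin d) ℝ) (y : Fin d → ℝ) :
    Zmat X *ᵥ y = Sum.elim (X *ᵥ y) (-y) := by
  rw [Zmat, fromRows_mulVec, neg_mulVec, one_mulVec]

lemma continuous_Zmat : Continuous (Zmat : Matrix (Fin n) (Fin d) ℝ → _) := by
  refine continuous_matrix fun i j => ?_
  rcases i with i | i
  · exact continuous_id.matrix_elem i j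
  · exact continuous_const

/-- The minimiser `(Zᵀ S Z)⁻¹ Zᵀ c` attached to the quadratic form `q`. -/
noncomputable def multiplier (c : Fin n ⊕ Fin d → ℝ)
    (S : Matrix (Fin n ⊕ Fin d) (Fin n ⊕ Fin d) ℝ) (X : Matrix (Fin n) (Fin d) ℝ) : Fin d → ℝ :=
  ((Zmat X)ᵀ * S * Zmat X)⁻¹ *ᵥ ((Zmat X)ᵀ *ᵥ c)

lemma q_eq (c : Fin n ⊕ Fin d → ℝ) (S : Matrix (Fin n ⊕ Fin d) (Fin n ⊕ Fin d) ℝ)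
    (X : Matrix (Fin n) (Fin d) ℝ) :
    q c S X = ((Zmat X)ᵀ *ᵥ c) ⬝ᵥ (((Zmat X)ᵀ * S * Zmat X)⁻¹ *ᵥ ((Zmat X)ᵀ *ᵥ c)) := by
  rw [q, ← mulVec_mulVec, ← mulVec_mulVec, dotProduct_mulVec c, ← mulVec_transpose]

/-- In this rank-one form, pairing with a direction `H` becomes a dot product with `H *ᵥ
multiplier`. -/
lemma s_eq_vecMulVec {S : Matrix (Fin n ⊕ Fin d) (Fin n ⊕ Fin d) ℝ} (hS : Sᵀ = S)
    (u : Fin n → ℝ) (v : Fin d → ℝ) (X : Matrix (Fin n) (Fin d) ℝ) :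
    s u v S X = vecMulVec
      (u - S.toRows₁ *ᵥ (Zmat X *ᵥ multiplier (Sum.elim u v) S X))
      (multiplier (Sum.elim u v) S X) := by
  have h1 : (Sum.elim u v ᵥ* Zmat X) ᵥ* ((Zmat X)ᵀ * S * Zmat X)⁻¹ =
      multiplier (Sum.elim u v) S X := by
    rw [multiplier, ← mulVec_transpose, ← mulVec_transpose, transpose_nonsing_inv]
    simp only [transpose_mul, transpose_transpose, hS, Matrix.mul_assoc]
  rw [s, sTilde, Matrix.sub_mul, Matrix.vecMulVec_mul, Matrix.vecMulVec_mul, h1,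
    Matrix.mul_assoc (_ * vecMulVec _ _), Matrix.mul_assoc _ (vecMulVec _ _), ← Matrix.mul_assoc (vecMulVec _ _),
    Matrix.vecMulVec_mul, Matrix.vecMulVec_mul, h1, Matrix.mul_vecMulVec, Matrix.sub_vecMulVec]
  simp only [multiplier, mulVec_mulVec, Matrix.mul_assoc]

/-- Completing the square in `y`. If `y` is the multiplier at `X`, the last form vanishes to second
order at `Y = X`, so the inverse never has to be differentiated. -/
lemma q_eq_add {S : Matrix (Fin n ⊕ Fin d) (Fin n ⊕ Fin d) ℝ} (hS : Sᵀ = S)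
    (c : Fin n ⊕ Fin d → ℝ) (Y : Matrix (Fin n) (Fin d) ℝ)
    (hY : IsUnit ((Zmat Y)ᵀ * S * Zmat Y).det) (y : Fin d → ℝ) :
    q c S Y = (2 * (c ⬝ᵥ (Zmat Y *ᵥ y)) - (Zmat Y *ᵥ y) ⬝ᵥ (S *ᵥ (Zmat Y *ᵥ y))) +
      ((Zmat Y)ᵀ *ᵥ (c - S *ᵥ (Zmat Y *ᵥ y))) ⬝ᵥ
        (((Zmat Y)ᵀ * S * Zmat Y)⁻¹ *ᵥ ((Zmat Y)ᵀ *ᵥ (c - S *ᵥ (Zmat Y *ᵥ y)))) := by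
  set M := (Zmat Y)ᵀ * S * Zmat Y with hM
  have hMt : Mᵀ = M := by
    rw [hM]; simp only [transpose_mul, transpose_transpose, hS, Matrix.mul_assoc]
  have h1 : (Zmat Y)ᵀ *ᵥ (S *ᵥ (Zmat Y *ᵥ y)) = M *ᵥ y := by
    rw [mulVec_mulVec, mulVec_mulVec]
  have h2 : (Zmat Y *ᵥ y) ⬝ᵥ (S *ᵥ (Zmat Y *ᵥ y)) = y ⬝ᵥ (M *ᵥ y) := by
    rw [← h1, dotProduct_mulVec y, ← mulVec_transpose, transpose_transpose]
  have h3 : c ⬝ᵥ (Zmat Y *ᵥ y) = y ⬝ᵥ ((Zmat Y)ᵀ *ᵥ c) := by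
    rw [dotProduct_mulVec, ← mulVec_transpose, dotProduct_comm]
  rw [q_eq, h2, h3, mulVec_sub, h1, ← hM]
  set t := (Zmat Y)ᵀ *ᵥ c
  have h4 : M⁻¹ *ᵥ (M *ᵥ y) = y := by
    rw [mulVec_mulVec, Matrix.nonsing_inv_mul _ hY, one_mulVec]
  have h5 : (M *ᵥ y) ⬝ᵥ (M⁻¹ *ᵥ t) = y ⬝ᵥ t := by
    rw [dotProduct_mulVec, ← mulVec_transpose, transpose_nonsing_inv, hMt, h4]
  rw [mulVec_sub, h4, sub_dotProduct, dotProduct_sub, dotProduct_sub, h5,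
    dotProduct_comm t y, dotProduct_comm (M *ᵥ y) y]
  ring

attribute [local instance] Matrix.normedAddCommGroup Matrix.normedSpace

/-- An `O(y - x)` factor times an `o(1)` factor is `o(y - x)`, so mere continuity of `g` suffices.
-/
lemma hasFDerivAt_mul_of_eq_zero {E : Type*} [NormedAddCommGroup E] [NormedSpace ℝ E]
    {f g : E → ℝ} {x : E} (hf : DifferentiableAt ℝ f x) (hf0 : f x = 0) (hg : ContinuousAt g x)
    (hg0 : g x = 0) : HasFDerivAt (fun y => f y * g y) (0 : E →L[ℝ] ℝ) x := by
  rw [hasFDerivAt_iff_isLittleO]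
  have h1 : (fun y => f y - f x) =O[𝓝 x] fun y => y - x := hf.hasFDerivAt.isBigO_sub
  have h2 : g =o[𝓝 x] fun _ => (1 : ℝ) := by
    rw [Asymptotics.isLittleO_one_iff]
    simpa [hg0] using hg.tendsto
  have h3 := h1.norm_right.mul_isLittleO h2
  simp only [hf0, sub_zero, mul_one] at h3
  simpa [hf0] using h3

lemma exists_hasFDerivAt_quadratic {E κ ν : Type*} [NormedAddCommGroup E] [NormedSpace ℝ E]
    [Fintype κ] [Fintype ν] (c : κ → ℝ) (S : Matrix κ κ ℝ) {v : κ → E → ℝ} {v' : κ → E →L[ℝ] ℝ}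
    {f g : ν → E → ℝ} {x : E} (hv : ∀ i, HasFDerivAt (v i) (v' i) x)
    (hf : ∀ j, DifferentiableAt ℝ (f j) x) (hf0 : ∀ j, f j x = 0)
    (hg : ∀ j, ContinuousAt (g j) x) (hg0 : ∀ j, g j x = 0) :
    ∃ L : E →L[ℝ] ℝ, HasFDerivAt (fun y => (2 * ∑ i, c i * v i y -
        ∑ i, v i y * ∑ k, S i k * v k y) + ∑ j, f j y * g j y) L x ∧
      ∀ H, L H = 2 * ∑ i, c i * v' i H -
        ∑ i, (v i x * ∑ k, S i k * v' k H + (∑ k, S i k * v k x) * v' i H) := by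
  have hmain := (((HasFDerivAt.fun_sum (u := Finset.univ) fun i (_ : i ∈ Finset.univ) =>
    (hv i).const_mul (c i)).const_mul 2).fun_sub
    (HasFDerivAt.fun_sum (u := Finset.univ) fun i (_ : i ∈ Finset.univ) => (hv i).fun_mul
      (HasFDerivAt.fun_sum (u := Finset.univ) fun k (_ : k ∈ Finset.univ) =>
        (hv k).const_mul (S i k)))).fun_add
    (HasFDerivAt.fun_sum (u := Finset.univ) fun j (_ : j ∈ Finset.univ) =>
      hasFDerivAt_mul_of_eq_zero (hf j) (hf0 j) (hg j) (hg0 j))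
  exact ⟨_, hmain, fun H => by simp⟩

lemma differentiableAt_Zmat_apply (X : Matrix (Fin n) (Fin d) ℝ) (i : Fin n ⊕ Fin d) (j : Fin d) :
    DifferentiableAt ℝ (fun Y : Matrix (Fin n) (Fin d) ℝ => Zmat Y i j) X := by
  rcases i with i | i
  · exact ((LinearMap.toContinuousLinearMap
      (Matrix.entryLinearMap ℝ ℝ i j : Matrix (Fin n) (Fin d) ℝ →ₗ[ℝ] ℝ)).differentiableAt :)
  · exact differentiableAt_const _

/-- Directional derivative of `Zmat Y *ᵥ y` in the matrix argument, as a linear map. -/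
noncomputable def ZmatMulVecDeriv (y : Fin d → ℝ) (i : Fin n ⊕ Fin d) :
    Matrix (Fin n) (Fin d) ℝ →L[ℝ] ℝ :=
  LinearMap.toContinuousLinearMap
    { toFun := fun H => (Sum.elim (H *ᵥ y) 0 : Fin n ⊕ Fin d → ℝ) i
      map_add' := fun H G => by rcases i with i | i <;> simp [add_mulVec]
      map_smul' := fun r H => by rcases i with i | i <;> simp [smul_mulVec] }

lemma ZmatMulVecDeriv_apply (y : Fin d → ℝ) (i : Fin n ⊕ Fin d) (H : Matrix (Fin n) (Fin d) ℝ) :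
    ZmatMulVecDeriv y i H = (Sum.elim (H *ᵥ y) 0 : Fin n ⊕ Fin d → ℝ) i := rfl

lemma hasFDerivAt_Zmat_mulVec (X : Matrix (Fin n) (Fin d) ℝ) (y : Fin d → ℝ)
    (i : Fin n ⊕ Fin d) :
    HasFDerivAt (fun Y => (Zmat Y *ᵥ y) i) (ZmatMulVecDeriv y i) X := by
  have h : (fun Y : Matrix (Fin n) (Fin d) ℝ => (Zmat Y *ᵥ y) i) =
      fun Y => ZmatMulVecDeriv y i Y + (Sum.elim 0 (-y) : Fin n ⊕ Fin d → ℝ) i := by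
    funext Y
    rw [Zmat_mulVec, ZmatMulVecDeriv_apply]
    rcases i with i | i <;> simp
  rw [h]
  exact ((ZmatMulVecDeriv y i).hasFDerivAt).add_const _

/-- `s` is half the gradient of `q`. -/
theorem hasFDerivAt_q {S : Matrix (Fin n ⊕ Fin d) (Fin n ⊕ Fin d) ℝ} (hS : Sᵀ = S)
    (u : Fin n → ℝ) (v : Fin d → ℝ) (X : Matrix (Fin n) (Fin d) ℝ)
    (hX : IsUnit ((Zmat X)ᵀ * S * Zmat X).det) :
    ∃ L : Matrix (Fin n) (Fin d) ℝ →L[ℝ] ℝ,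
      HasFDerivAt (fun Y => q (Sum.elim u v) S Y) L X ∧
      ∀ H, L H = 2 * (s u v S X * Hᵀ).trace := by
  set c : Fin n ⊕ Fin d → ℝ := Sum.elim u v with hc
  set y := multiplier c S X with hy
  set r : Matrix (Fin n) (Fin d) ℝ → Fin d → ℝ :=
    fun Y => (Zmat Y)ᵀ *ᵥ (c - S *ᵥ (Zmat Y *ᵥ y)) with hr
  have hcM : Continuous fun Y : Matrix (Fin n) (Fin d) ℝ => (Zmat Y)ᵀ * S * Zmat Y :=
    (continuous_Zmat.matrix_transpose.matrix_mul continuous_const).matrix_mul continuous_Zmat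
  have hr0 : r X = 0 := by
    simp only [hr, hy, multiplier, mulVec_sub, mulVec_mulVec]
    rw [← Matrix.mul_assoc, ← Matrix.mul_assoc, ← Matrix.mul_assoc, Matrix.mul_nonsing_inv _ hX, Matrix.one_mul, sub_self]
  have hdr : ∀ j, DifferentiableAt ℝ (fun Y => r Y j) X := fun j => by
    simp only [hr, mulVec, dotProduct, transpose_apply, Pi.sub_apply]
    refine DifferentiableAt.fun_sum fun i _ => (differentiableAt_Zmat_apply X i j).mul
      ((differentiableAt_const _).sub (DifferentiableAt.fun_sum fun k _ => ?_))
    exact (hasFDerivAt_Zmat_mulVec X y k).differentiableAt.const_mul _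
  have hinv : ContinuousAt (fun Y => ((Zmat Y)ᵀ * S * Zmat Y)⁻¹) X := by
    refine ContinuousAt.comp (g := Inv.inv) (f := fun Y => (Zmat Y)ᵀ * S * Zmat Y) ?_
      hcM.continuousAt
    refine continuousAt_matrix_inv _ ?_
    simp only [Ring.inverse_eq_inv']
    exact continuousAt_inv₀ hX.ne_zero
  have hg : ∀ j, ContinuousAt (fun Y => (((Zmat Y)ᵀ * S * Zmat Y)⁻¹ *ᵥ r Y) j) X := fun j => by
    simp only [mulVec, dotProduct]
    refine tendsto_finsetSum _ fun i _ => Tendsto.mul ?_ (hdr i).continuousAt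
    exact ((continuous_id.matrix_elem j i).tendsto _).comp hinv
  obtain ⟨L, hL, hLH⟩ := exists_hasFDerivAt_quadratic c S (hasFDerivAt_Zmat_mulVec X y) hdr
    (fun j => congrFun hr0 j) hg (fun j => by simp [hr0])
  refine ⟨L, hL.congr_of_eventuallyEq ?_, fun H => ?_⟩
  · have hopen : ∀ᶠ Y in 𝓝 X, ((Zmat Y)ᵀ * S * Zmat Y).det ≠ 0 :=
      (hcM.matrix_det.continuousAt).eventually_ne hX.ne_zero
    filter_upwards [hopen] with Y hY
    rw [q_eq_add hS c Y hY.isUnit y]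
    simp [dotProduct, mulVec, hr]
  · rw [s_eq_vecMulVec hS, ← hc, ← hy, vecMulVec_mul, trace_vecMulVec, vecMul_transpose]
    -- The derivative of `Zmat Y *ᵥ y` along `H`. It lives on the first `n` coordinates, which is
    -- why only the first `n` rows of `S` enter `s`.
    set h : Fin n ⊕ Fin d → ℝ := Sum.elim (H *ᵥ y) 0 with hh
    have h1 : (S *ᵥ h) ⬝ᵥ (Zmat X *ᵥ y) = h ⬝ᵥ (S *ᵥ (Zmat X *ᵥ y)) := by
      rw [dotProduct_mulVec h, ← mulVec_transpose, hS]
    have h2 : ∀ w, h ⬝ᵥ w = (H *ᵥ y) ⬝ᵥ fun i => w (Sum.inl i) := fun w => by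
      simp [dotProduct, hh]
    have h3 : (S.toRows₁ *ᵥ (Zmat X *ᵥ y)) = fun i => (S *ᵥ (Zmat X *ᵥ y)) (Sum.inl i) := rfl
    have h4 : u = fun i => c (Sum.inl i) := rfl
    rw [sub_dotProduct, h3, dotProduct_comm _ (H *ᵥ y), dotProduct_comm _ (H *ᵥ y), ← h2, h4, ← h2, two_mul]
    refine (hLH H).trans ?_
    change 2 * ∑ i, c i * h i - ∑ i, ((Zmat X *ᵥ y) i * ∑ k, S i k * h k +
      (∑ k, S i k * (Zmat X *ᵥ y) k) * h i) = _
    have h5 : ∑ i, c i * h i = h ⬝ᵥ c := by simp [dotProduct, mul_comm]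
    have h6 : ∑ i, ((Zmat X *ᵥ y) i * ∑ k, S i k * h k + (∑ k, S i k * (Zmat X *ᵥ y) k) * h i) =
        h ⬝ᵥ (S *ᵥ (Zmat X *ᵥ y)) + h ⬝ᵥ (S *ᵥ (Zmat X *ᵥ y)) := by
      rw [Finset.sum_add_distrib]
      congr 1
      · rw [← h1, dotProduct_comm]; rfl
      · rw [dotProduct_comm]; rfl
    rw [h5, h6]
    ring

end Gradient

/-! ### Elimination of the corrections; existence of minimisers. -/

section Reduction

open Matrix

variable {n d : ℕ} {J : Finset (Fin n ⊕ Fin d)}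

/-- The profile objective: the minimal cost for a fixed parameter. -/
noncomputable def objective (J : Finset (Fin n ⊕ Fin d)) (Sig : ℕ → Matrix J J ℝ)
    (c : ℕ → Fin n ⊕ Fin d → ℝ) (m : ℕ) (X : Matrix (Fin n) (Fin d) ℝ) : ℝ :=
  ∑ i ∈ Finset.range m, ((Zmat X)ᵀ *ᵥ c i) ⬝ᵥ
    (((ZJ J X)ᵀ * Sig i * ZJ J X)⁻¹ *ᵥ ((Zmat X)ᵀ *ᵥ c i))

lemma sum_eq_sum_subtype {f : Fin n ⊕ Fin d → ℝ} (hf : ∀ j ∉ J, f j = 0) :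
    ∑ j, f j = ∑ j : J, f j := by
  rw [Finset.sum_coe_sort J f]
  exact (Finset.sum_subset (Finset.subset_univ J) fun j _ hj => hf j hj).symm

lemma Zmat_transpose_mulVec (X : Matrix (Fin n) (Fin d) ℝ) (x : Fin n ⊕ Fin d → ℝ) :
    (Zmat X)ᵀ *ᵥ x = Xᵀ *ᵥ (fun k => x (Sum.inl k)) - fun j => x (Sum.inr j) := by
  ext j
  simp [mulVec, dotProduct, Zmat, Matrix.one_apply, sub_eq_add_neg]

lemma Zmat_transpose_mulVec_eq_ZJ (X : Matrix (Fin n) (Fin d) ℝ) {x : Fin n ⊕ Fin d → ℝ}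
    (hx : ∀ j ∉ J, x j = 0) : (Zmat X)ᵀ *ᵥ x = (ZJ J X)ᵀ *ᵥ fun j : J => x j := by
  ext k
  exact sum_eq_sum_subtype (f := fun j => Zmat X j k * x j) fun j hj => by simp [hx j hj]

lemma gram_eq_gram_ZJ (X : Matrix (Fin n) (Fin d) ℝ)
    {S : Matrix (Fin n ⊕ Fin d) (Fin n ⊕ Fin d) ℝ} {T : Matrix J J ℝ}
    (hin : ∀ j k : J, S j k = T j k) (hl : ∀ j ∉ J, ∀ k, S j k = 0) (hr : ∀ j, ∀ k ∉ J, S j k = 0) :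
    (Zmat X)ᵀ * S * Zmat X = (ZJ J X)ᵀ * T * ZJ J X := by
  ext a b
  simp only [Matrix.mul_apply, transpose_apply]
  rw [sum_eq_sum_subtype (J := J) fun k hk => by simp [hr _ k hk]]
  refine Finset.sum_congr rfl fun k _ => ?_
  rw [sum_eq_sum_subtype (J := J) fun j hj => by simp [hl j hj]]
  simp [ZJ, hin]

lemma isOpen_setOf_rank_eq : IsOpen {X : Matrix (Fin n) (Fin d) ℝ | (ZJ J X).rank = d} := by
  have h : {X : Matrix (Fin n) (Fin d) ℝ | (ZJ J X).rank = d} =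
      {X | ((ZJ J X)ᵀ * ZJ J X).det ≠ 0} := by
    ext X
    simpa using rank_eq_card_iff (Z := ZJ J X)
  rw [h]
  have hc : Continuous fun X : Matrix (Fin n) (Fin d) ℝ => ZJ J X :=
    continuous_matrix fun i j => continuous_Zmat.matrix_elem _ _
  exact isOpen_ne_fun (hc.matrix_transpose.matrix_mul hc).matrix_det continuous_const

/-- The equation `(A - ΔA) X = B - ΔB` says that `Zᵀ` annihilates each row of `C - ΔC`, and `ΔC`
lives on the columns in `J`. -/
lemma Feasible.mulVec_eq {m : ℕ} {C ΔC : Matrix (Fin m) (Fin n ⊕ Fin d) ℝ}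
    {X : Matrix (Fin n) (Fin d) ℝ} (h : Feasible J C X ΔC) (i : Fin m) :
    (ZJ J X)ᵀ *ᵥ (fun j : J => ΔC i j) = (Zmat X)ᵀ *ᵥ C i := by
  rw [← Zmat_transpose_mulVec_eq_ZJ X (h.zero i), Zmat_transpose_mulVec, Zmat_transpose_mulVec]
  ext j
  have h1 := congrFun (congrFun h.eq i) j
  simp only [Matrix.mul_apply, Matrix.sub_apply, toCols₁_apply, toCols₂_apply, sub_mul,
    Finset.sum_sub_distrib] at h1
  simp only [mulVec, dotProduct, transpose_apply, Pi.sub_apply, mul_comm (X _ _)]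
  linarith

variable {m : ℕ} {Sig : ℕ → Matrix J J ℝ} {c : ℕ → Fin n ⊕ Fin d → ℝ}

lemma objective_le_cost (hpd : ∀ i, (Sig i).PosDef) {X : Matrix (Fin n) (Fin d) ℝ}
    {ΔC : Matrix (Fin m) (Fin n ⊕ Fin d) ℝ}
    (h : Feasible J (Matrix.of fun i : Fin m => c i) X ΔC) :
    objective J Sig c m X ≤ cost J (fun i : Fin m => Sig i) ΔC := by
  rw [objective, Finset.sum_range, cost]
  refine Finset.sum_le_sum fun i _ => ?_
  rw [norm_sq_inv_sqrt_mulVec (hpd i)]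
  have h1 : (Zmat X)ᵀ *ᵥ c i = (ZJ J X)ᵀ *ᵥ (fun j : J => ΔC i j) := (h.mulVec_eq i).symm
  rw [h1]
  exact dotProduct_inv_gram_le (by simpa using h.rank) (hpd i) _

lemma exists_feasible_cost_eq (hpd : ∀ i, (Sig i).PosDef) (m : ℕ) {X : Matrix (Fin n) (Fin d) ℝ}
    (hX : (ZJ J X).rank = d) :
    ∃ ΔC : Matrix (Fin m) (Fin n ⊕ Fin d) ℝ, Feasible J (Matrix.of fun i : Fin m => c i) X ΔC ∧
      cost J (fun i : Fin m => Sig i) ΔC = objective J Sig c m X := by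
  have hex := fun i => exists_dotProduct_inv_eq (Z := ZJ J X) (by simpa using hX) (hpd i)
    ((Zmat X)ᵀ *ᵥ c i)
  choose v hv hcost using hex
  let ΔC : Matrix (Fin m) (Fin n ⊕ Fin d) ℝ :=
    Matrix.of fun i j => if h : j ∈ J then v i ⟨j, h⟩ else 0
  have hzero : ∀ i, ∀ j ∉ J, ΔC i j = 0 := fun i j hj => by simp [ΔC, hj]
  have hJ : ∀ i : Fin m, (fun j : J => ΔC i j) = v i := fun i => by ext j; simp [ΔC]
  refine ⟨ΔC, ⟨?_, hzero, hX⟩, ?_⟩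
  · ext i j
    have h1 : (Zmat X)ᵀ *ᵥ ΔC i = (Zmat X)ᵀ *ᵥ c i := by
      rw [Zmat_transpose_mulVec_eq_ZJ X (hzero i), hJ, hv]
    rw [Zmat_transpose_mulVec, Zmat_transpose_mulVec] at h1
    have h2 := congrFun h1 j
    simp only [mulVec, dotProduct, transpose_apply, Pi.sub_apply, mul_comm (X _ _)] at h2
    simp only [Matrix.mul_apply, Matrix.sub_apply, toCols₁_apply, toCols₂_apply, sub_mul,
      Finset.sum_sub_distrib, Matrix.of_apply]
    linarith
  · rw [objective, Finset.sum_range, cost]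
    refine Finset.sum_congr rfl fun i _ => ?_
    rw [norm_sq_inv_sqrt_mulVec (hpd i), hJ, hcost]

/-- For fixed `X` the rows decouple, and the least cost over the corrections is exactly `objective`.
-/
lemma isSolution_iff (hpd : ∀ i, (Sig i).PosDef) {X : Matrix (Fin n) (Fin d) ℝ} :
    IsSolution J (fun i : Fin m => Sig i) (Matrix.of fun i : Fin m => c i) X ↔
      (ZJ J X).rank = d ∧ ∀ X', (ZJ J X').rank = d →
        objective J Sig c m X ≤ objective J Sig c m X' := by
  constructor
  · rintro ⟨ΔC, hf, hmin⟩
    refine ⟨hf.rank, fun X' hX' => ?_⟩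
    obtain ⟨ΔC', hf', hc'⟩ := exists_feasible_cost_eq (c := c) hpd m hX'
    exact (objective_le_cost hpd hf).trans ((hmin X' ΔC' hf').trans hc'.le)
  · rintro ⟨hX, hmin⟩
    obtain ⟨ΔC, hf, hc⟩ := exists_feasible_cost_eq (c := c) hpd m hX
    exact ⟨ΔC, hf, fun X' ΔC' hf' =>
      hc.le.trans ((hmin X' hf'.rank).trans (objective_le_cost hpd hf'))⟩

variable {S : ℕ → Matrix (Fin n ⊕ Fin d) (Fin n ⊕ Fin d) ℝ}

lemma objective_eq_sum_q
    (hg : ∀ i X, (Zmat X)ᵀ * S i * Zmat X = (ZJ J X)ᵀ * Sig i * ZJ J X)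
    (X : Matrix (Fin n) (Fin d) ℝ) :
    objective J Sig c m X = ∑ i ∈ Finset.range m, q (c i) (S i) X := by
  simp only [objective, q_eq, hg]

attribute [local instance] Matrix.normedAddCommGroup Matrix.normedSpace

lemma exists_hasFDerivAt_objective (hpd : ∀ i, (Sig i).PosDef) (hS : ∀ i, (S i)ᵀ = S i)
    (hg : ∀ i X, (Zmat X)ᵀ * S i * Zmat X = (ZJ J X)ᵀ * Sig i * ZJ J X)
    {X : Matrix (Fin n) (Fin d) ℝ} (hX : (ZJ J X).rank = d) :
    ∃ L : Matrix (Fin n) (Fin d) ℝ →L[ℝ] ℝ, HasFDerivAt (objective J Sig c m) L X ∧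
      ∀ H, L H = 2 * ((∑ i ∈ Finset.range m,
        s (fun k => c i (Sum.inl k)) (fun k => c i (Sum.inr k)) (S i) X) * Hᵀ).trace := by
  have hdet : ∀ i, IsUnit ((Zmat X)ᵀ * S i * Zmat X).det := fun i => by
    rw [hg]
    exact isUnit_det_gram (by simpa using hX) (hpd i)
  choose L hL hLH using fun i => hasFDerivAt_q (hS i) (fun k => c i (Sum.inl k))
    (fun k => c i (Sum.inr k)) X (hdet i)
  have hc : ∀ i, Sum.elim (fun k => c i (Sum.inl k)) (fun k => c i (Sum.inr k)) = c i :=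
    fun i => by ext j; rcases j with j | j <;> rfl
  refine ⟨∑ i ∈ Finset.range m, L i, ?_, fun H => ?_⟩
  · have h := HasFDerivAt.fun_sum (u := Finset.range m) fun i _ => hL i
    simp only [hc] at h
    refine h.congr_of_eventuallyEq (Eventually.of_forall fun Y => ?_)
    exact objective_eq_sum_q hg Y
  · rw [Matrix.sum_mul, trace_sum, Finset.mul_sum, ← Finset.sum_congr rfl fun i _ => hLH i H]
    simp

lemma sum_s_eq_zero_of_isSolution (hpd : ∀ i, (Sig i).PosDef) (hS : ∀ i, (S i)ᵀ = S i)
    (hg : ∀ i X, (Zmat X)ᵀ * S i * Zmat X = (ZJ J X)ᵀ * Sig i * ZJ J X)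
    {X : Matrix (Fin n) (Fin d) ℝ}
    (hX : IsSolution J (fun i : Fin m => Sig i) (Matrix.of fun i : Fin m => c i) X) :
    ∑ i ∈ Finset.range m,
      s (fun k => c i (Sum.inl k)) (fun k => c i (Sum.inr k)) (S i) X = 0 := by
  obtain ⟨hr, hmin⟩ := (isSolution_iff hpd).mp hX
  obtain ⟨L, hL, hLH⟩ := exists_hasFDerivAt_objective (c := c) (m := m) hpd hS hg hr
  have hloc : IsLocalMin (objective J Sig c m) X := by
    filter_upwards [isOpen_setOf_rank_eq.mem_nhds hr] with Y hY using hmin Y hY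
  have h0 : L = 0 := hloc.hasFDerivAt_eq_zero hL
  set F := ∑ i ∈ Finset.range m,
    s (fun k => c i (Sum.inl k)) (fun k => c i (Sum.inr k)) (S i) X
  -- The vanishing derivative is tested in the direction of the gradient itself, giving `tr (F Fᵀ) =
  -- 0`.
  have h1 := hLH F
  have h2 : L F = 0 := by rw [h0]; rfl
  have h3 : (F * Fᵀ).trace = 0 := by linarith
  exact (Matrix.trace_mul_conjTranspose_self_eq_zero_iff (A := F)).mp (by simpa using h3)

/-- The continuous objective has a minimum on the compact ball. Since `X₀` is in the ball, `hout`
makes this minimum global. -/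
lemma exists_isSolution (hpd : ∀ i, (Sig i).PosDef) (hS : ∀ i, (S i)ᵀ = S i)
    (hg : ∀ i X, (Zmat X)ᵀ * S i * Zmat X = (ZJ J X)ᵀ * Sig i * ZJ J X)
    {X₀ : Matrix (Fin n) (Fin d) ℝ} {ε : ℝ} (hε : 0 < ε)
    (hin : ∀ X : Matrix (Fin n) (Fin d) ℝ, dist X X₀ ≤ ε → (ZJ J X).rank = d)
    (hout : ∀ X : Matrix (Fin n) (Fin d) ℝ, (ZJ J X).rank = d → ε < dist X X₀ →
      objective J Sig c m X₀ ≤ objective J Sig c m X) :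
    ∃ X, IsSolution J (fun i : Fin m => Sig i) (Matrix.of fun i : Fin m => c i) X := by
  have hcomp : IsCompact (Metric.closedBall X₀ ε) :=
    haveI : ProperSpace (Matrix (Fin n) (Fin d) ℝ) := FiniteDimensional.proper ℝ _
    isCompact_closedBall X₀ ε
  have hcont : ContinuousOn (objective J Sig c m) (Metric.closedBall X₀ ε) := fun X hX => by
    obtain ⟨L, hL, -⟩ := exists_hasFDerivAt_objective (c := c) (m := m) hpd hS hg (hin X hX)
    exact hL.continuousAt.continuousWithinAt
  obtain ⟨X, hX, hmin⟩ := hcomp.exists_isMinOn ⟨X₀, Metric.mem_closedBall_self hε.le⟩ hcont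
  refine ⟨X, (isSolution_iff hpd).mpr ⟨hin X hX, fun X' hX' => ?_⟩⟩
  by_cases h : dist X' X₀ ≤ ε
  · exact hmin h
  · exact (hmin (Metric.mem_closedBall_self hε.le)).trans (hout X' hX' (not_le.mp h))

lemma exists_closedBall_rank_eq {X₀ : Matrix (Fin n) (Fin d) ℝ} (h : (ZJ J X₀).rank = d) :
    ∃ ε : ℝ, 0 < ε ∧ ∀ X : Matrix (Fin n) (Fin d) ℝ, dist X X₀ ≤ ε → (ZJ J X).rank = d := by
  obtain ⟨ε, hε, hsub⟩ := Metric.nhds_basis_closedBall.mem_iff.mp (isOpen_setOf_rank_eq.mem_nhds h)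
  exact ⟨ε, hε, fun X hX => hsub hX⟩

end Reduction

/-! ### Deterministic lower bound away from `X₀`. -/

section LowerBound

open Matrix

variable {n d : ℕ} {J : Finset (Fin n ⊕ Fin d)}

/-- `(X - X₀) (Z_Jᵀ Z_J)⁻¹ Z_Jᵀ`, a scale-free deviation of `X` from `X₀`. -/
noncomputable def deviation (J : Finset (Fin n ⊕ Fin d)) (X₀ X : Matrix (Fin n) (Fin d) ℝ) :
    Matrix (Fin n) J ℝ :=
  (X - X₀) * ((ZJ J X)ᵀ * ZJ J X)⁻¹ * (ZJ J X)ᵀ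

lemma deviation_mul_ZJ {X₀ X : Matrix (Fin n) (Fin d) ℝ} (hX : (ZJ J X).rank = d) :
    deviation J X₀ X * ZJ J X = X - X₀ := by
  have h : ((ZJ J X)ᵀ * ZJ J X).det ≠ 0 := rank_eq_card_iff.mp (by simpa using hX)
  rw [deviation, Matrix.mul_assoc, Matrix.mul_assoc, Matrix.nonsing_inv_mul _ h.isUnit,
    Matrix.mul_one]

/-- The true row contributes `(X - X₀)ᵀ a₀`, and `X - X₀ = L Z_J` by full rank. Signal and error
thus become vectors of one space, indexed by `J`. -/
lemma Zmat_transpose_mulVec_obsRow {X₀ X : Matrix (Fin n) (Fin d) ℝ} (hX : (ZJ J X).rank = d)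
    (a₀ : Fin n → ℝ) {e : Fin n ⊕ Fin d → ℝ} (he : ∀ j ∉ J, e j = 0) :
    (Zmat X)ᵀ *ᵥ obsRow X₀ a₀ e =
      (ZJ J X)ᵀ *ᵥ ((deviation J X₀ X)ᵀ *ᵥ a₀ + fun j : J => e j) := by
  rw [obsRow, mulVec_add, mulVec_add, Zmat_transpose_mulVec_eq_ZJ X he]
  congr 1
  rw [mulVec_mulVec, ← transpose_mul, deviation_mul_ZJ hX, transpose_sub, sub_mulVec,
    Zmat_transpose_mulVec]
  rfl

lemma objective_obsRow_eq {Sig : ℕ → Matrix J J ℝ} {X₀ X : Matrix (Fin n) (Fin d) ℝ}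
    (hX : (ZJ J X).rank = d) (a₀ : ℕ → Fin n → ℝ) {e : ℕ → Fin n ⊕ Fin d → ℝ} {m : ℕ}
    (he : ∀ i, ∀ j ∉ J, e i j = 0) :
    objective J Sig (fun i => obsRow X₀ (a₀ i) (e i)) m X = ∑ i ∈ Finset.range m,
      ((deviation J X₀ X)ᵀ *ᵥ a₀ i + fun j : J => e i j) ⬝ᵥ (wproj (ZJ J X) (Sig i) *ᵥ
        ((deviation J X₀ X)ᵀ *ᵥ a₀ i + fun j : J => e i j)) := by
  refine Finset.sum_congr rfl fun i _ => ?_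
  rw [Zmat_transpose_mulVec_obsRow hX _ (he i), wproj, ← mulVec_mulVec, ← mulVec_mulVec]
  set y := (deviation J X₀ X)ᵀ *ᵥ a₀ i + fun j : J => e i j
  rw [dotProduct_mulVec y, ← mulVec_transpose]

lemma sum_dotProduct_transpose_mulVec (a₀ : ℕ → Fin n → ℝ) (m : ℕ) {κ : Type*} [Fintype κ]
    (L : Matrix (Fin n) κ ℝ) :
    ∑ i ∈ Finset.range m, (Lᵀ *ᵥ a₀ i) ⬝ᵥ (Lᵀ *ᵥ a₀ i) =
      ∑ b, (fun k => L k b) ⬝ᵥ (((inputMat a₀ m)ᵀ * inputMat a₀ m) *ᵥ fun k => L k b) := by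
  have h1 : ∀ b, (fun k => L k b) ⬝ᵥ (((inputMat a₀ m)ᵀ * inputMat a₀ m) *ᵥ fun k => L k b) =
      ∑ i ∈ Finset.range m, (Lᵀ *ᵥ a₀ i) b * (Lᵀ *ᵥ a₀ i) b := fun b => by
    rw [← mulVec_mulVec, dotProduct_mulVec, ← mulVec_transpose, transpose_transpose,
      Finset.sum_range]
    refine Finset.sum_congr rfl fun i _ => ?_
    simp [mulVec, dotProduct, inputMat, mul_comm]
  simp_rw [h1]
  rw [Finset.sum_comm]
  rfl

lemma isHermitian_gram_inputMat (a₀ : ℕ → Fin n → ℝ) (m : ℕ) :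
    ((inputMat a₀ m)ᵀ * inputMat a₀ m).IsHermitian := by
  simp [Matrix.IsHermitian]

/-- Deterministic lower bound for the increase of the objective. -/
lemma objective_sub_ge {Sig : ℕ → Matrix J J ℝ} (hpd : ∀ i, (Sig i).PosDef) {K : ℝ} (hK : 0 < K)
    (hup : ∀ i (x : J → ℝ), x ⬝ᵥ (Sig i *ᵥ x) ≤ K * (x ⬝ᵥ x))
    {X₀ X : Matrix (Fin n) (Fin d) ℝ} (hX₀ : (ZJ J X₀).rank = d) (hX : (ZJ J X).rank = d)
    (a₀ : ℕ → Fin n → ℝ) {e : ℕ → Fin n ⊕ Fin d → ℝ} {m : ℕ} (he : ∀ i, ∀ j ∉ J, e i j = 0)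
    (v : ℝ) {B₁ B₂ : ℝ}
    (hB₁ : ∀ (k : Fin n) (a b : J),
      |∑ i ∈ Finset.range m, (a₀ i k * e i b) * wproj (ZJ J X) (Sig i) a b| ≤ B₁)
    (hB₂ : ∀ Y, (ZJ J Y).rank = d → ∀ (a b : J),
      |∑ i ∈ Finset.range m, (e i a * e i b - v * Sig i a b) * wproj (ZJ J Y) (Sig i) a b| ≤ B₂)
    {ℓ : ℝ} (hℓ : ∀ k b, |deviation J X₀ X k b| ≤ ℓ)
    (hℓ2 : ℓ ^ 2 = ∑ b, ∑ k, deviation J X₀ X k b ^ 2) (hℓ0 : 0 ≤ ℓ) :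
    K⁻¹ * (lambdaMin ((inputMat a₀ m)ᵀ * inputMat a₀ m) * ℓ ^ 2) -
        2 * (n * J.card ^ 2 * (ℓ * B₁)) - 2 * (J.card ^ 2 * B₂) ≤
      objective J Sig (fun i => obsRow X₀ (a₀ i) (e i)) m X -
        objective J Sig (fun i => obsRow X₀ (a₀ i) (e i)) m X₀ := by
  set L := deviation J X₀ X with hL
  have hsymm : ∀ i, (Sig i)ᵀ = Sig i := fun i => by
    simpa [Matrix.IsHermitian] using (hpd i).isHermitian
  -- By `trace_wproj_mul`, subtracting `v * Sig i` from the products of errors removes exactly `v *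
  -- d` per row. This is the same at `X` and `X₀`.
  have hquad : ∀ Y, (ZJ J Y).rank = d →
      |∑ i ∈ Finset.range m, (fun j : J => e i j) ⬝ᵥ (wproj (ZJ J Y) (Sig i) *ᵥ fun j : J => e i j)
        - m * (v * d)| ≤ J.card ^ 2 * B₂ := fun Y hY => by
    have h1 : ∀ i, (fun j : J => e i j) ⬝ᵥ (wproj (ZJ J Y) (Sig i) *ᵥ fun j : J => e i j) =
        ∑ a : J, ∑ b : J, (e i a * e i b - v * Sig i a b) * wproj (ZJ J Y) (Sig i) a b + v * d :=
      fun i => by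
        have h2 := trace_wproj_mul (isUnit_det_gram (Z := ZJ J Y) (by simpa using hY) (hpd i))
        have h3 : (wproj (ZJ J Y) (Sig i) * Sig i).trace =
            ∑ a : J, ∑ b : J, Sig i a b * wproj (ZJ J Y) (Sig i) a b := by
          simp only [Matrix.trace, diag_apply, Matrix.mul_apply]
          refine Finset.sum_congr rfl fun a _ => Finset.sum_congr rfl fun b _ => ?_
          rw [mul_comm]
          congr 1
          exact congrFun (congrFun (hsymm i) a) b
        rw [h3, Fintype.card_fin] at h2
        rw [← h2]
        simp only [sub_mul, Finset.sum_sub_distrib, Finset.mul_sum, dotProduct, mulVec]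
        simp only [mul_assoc, sub_add_cancel]
        refine Finset.sum_congr rfl fun a _ => Finset.sum_congr rfl fun b _ => by ring
    simp_rw [h1]
    rw [Finset.sum_add_distrib, Finset.sum_const, Finset.card_range, nsmul_eq_mul,
      add_sub_cancel_right, Finset.sum_comm]
    refine (Finset.abs_sum_le_sum_abs _ _).trans ?_
    calc ∑ a : J, |∑ i ∈ Finset.range m, ∑ b : J,
          (e i a * e i b - v * Sig i a b) * wproj (ZJ J Y) (Sig i) a b|
        ≤ ∑ _a : J, ∑ _b : J, B₂ := by
          refine Finset.sum_le_sum fun a _ => ?_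
          rw [Finset.sum_comm]
          exact (Finset.abs_sum_le_sum_abs _ _).trans (Finset.sum_le_sum fun b _ => hB₂ Y hY a b)
      _ = J.card ^ 2 * B₂ := by
          simp only [Finset.sum_const, Finset.card_univ, Fintype.card_coe, nsmul_eq_mul]
          ring
  have hcross : |∑ i ∈ Finset.range m, (Lᵀ *ᵥ a₀ i) ⬝ᵥ
      (wproj (ZJ J X) (Sig i) *ᵥ fun j : J => e i j)| ≤ n * J.card ^ 2 * (ℓ * B₁) := by
    have h1 : ∑ i ∈ Finset.range m, (Lᵀ *ᵥ a₀ i) ⬝ᵥ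
        (wproj (ZJ J X) (Sig i) *ᵥ fun j : J => e i j) =
        ∑ k : Fin n, ∑ a : J, ∑ b : J, L k a *
          ∑ i ∈ Finset.range m, (a₀ i k * e i b) * wproj (ZJ J X) (Sig i) a b := by
      have h2 : ∀ i, (Lᵀ *ᵥ a₀ i) ⬝ᵥ (wproj (ZJ J X) (Sig i) *ᵥ fun j : J => e i j) =
          ∑ k : Fin n, ∑ a : J, ∑ b : J,
            L k a * ((a₀ i k * e i b) * wproj (ZJ J X) (Sig i) a b) := fun i => by
        simp only [dotProduct, mulVec, transpose_apply]
        rw [Finset.sum_comm]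
        refine Finset.sum_congr rfl fun a _ => ?_
        rw [Finset.sum_mul]
        refine Finset.sum_congr rfl fun k _ => ?_
        rw [Finset.mul_sum]
        exact Finset.sum_congr rfl fun b _ => by ring
      simp_rw [h2]
      rw [Finset.sum_comm]
      refine Finset.sum_congr rfl fun k _ => ?_
      rw [Finset.sum_comm]
      refine Finset.sum_congr rfl fun a _ => ?_
      rw [Finset.sum_comm]
      exact Finset.sum_congr rfl fun b _ => by rw [Finset.mul_sum]
    rw [h1]
    calc |∑ k : Fin n, ∑ a : J, ∑ b : J, L k a *
          ∑ i ∈ Finset.range m, (a₀ i k * e i b) * wproj (ZJ J X) (Sig i) a b|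
        ≤ ∑ _k : Fin n, ∑ _a : J, ∑ _b : J, ℓ * B₁ := by
          refine (Finset.abs_sum_le_sum_abs _ _).trans (Finset.sum_le_sum fun k _ => ?_)
          refine (Finset.abs_sum_le_sum_abs _ _).trans (Finset.sum_le_sum fun a _ => ?_)
          refine (Finset.abs_sum_le_sum_abs _ _).trans (Finset.sum_le_sum fun b _ => ?_)
          rw [abs_mul]
          exact mul_le_mul (hℓ k a) (hB₁ k a b) (abs_nonneg _) hℓ0
      _ = n * J.card ^ 2 * (ℓ * B₁) := by
          simp only [Finset.sum_const, Finset.card_univ, Fintype.card_coe, Fintype.card_fin,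
            nsmul_eq_mul]
          ring
  have hsig : K⁻¹ * (lambdaMin ((inputMat a₀ m)ᵀ * inputMat a₀ m) * ℓ ^ 2) ≤
      ∑ i ∈ Finset.range m, (Lᵀ *ᵥ a₀ i) ⬝ᵥ (wproj (ZJ J X) (Sig i) *ᵥ (Lᵀ *ᵥ a₀ i)) := by
    have h1 : lambdaMin ((inputMat a₀ m)ᵀ * inputMat a₀ m) * ℓ ^ 2 ≤
        ∑ i ∈ Finset.range m, (Lᵀ *ᵥ a₀ i) ⬝ᵥ (Lᵀ *ᵥ a₀ i) := by
      rw [sum_dotProduct_transpose_mulVec, hℓ2, Finset.mul_sum]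
      refine Finset.sum_le_sum fun b _ => ?_
      have h2 := lambdaMin_mul_le (isHermitian_gram_inputMat a₀ m) fun k => L k b
      simpa [dotProduct, sq] using h2
    refine (mul_le_mul_of_nonneg_left h1 (inv_pos.mpr hK).le).trans ?_
    rw [Finset.mul_sum]
    refine Finset.sum_le_sum fun i _ => ?_
    -- The signal lies in the range of `Z_J`, where the weight is bounded below.
    have h3 : Lᵀ *ᵥ a₀ i =
        ZJ J X *ᵥ ((((ZJ J X)ᵀ * ZJ J X)⁻¹)ᵀ *ᵥ ((X - X₀)ᵀ *ᵥ a₀ i)) := by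
      rw [hL, deviation]
      simp only [transpose_mul, mulVec_mulVec, transpose_transpose, Matrix.mul_assoc]
    rw [h3]
    exact le_dotProduct_wproj (hsymm i) (isUnit_det_gram (by simpa using hX) (hpd i))
      (fun x => by simpa using (hpd i).posSemidef.dotProduct_mulVec_nonneg x) hK (hup i) _
  have hdev0 : deviation J X₀ X₀ = 0 := by simp [deviation]
  rw [objective_obsRow_eq hX a₀ he, objective_obsRow_eq hX₀ a₀ he, hdev0, ← hL]
  have hexp : ∀ i, (Lᵀ *ᵥ a₀ i + fun j : J => e i j) ⬝ᵥ (wproj (ZJ J X) (Sig i) *ᵥ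
        (Lᵀ *ᵥ a₀ i + fun j : J => e i j)) =
      (Lᵀ *ᵥ a₀ i) ⬝ᵥ (wproj (ZJ J X) (Sig i) *ᵥ (Lᵀ *ᵥ a₀ i)) +
      2 * ((Lᵀ *ᵥ a₀ i) ⬝ᵥ (wproj (ZJ J X) (Sig i) *ᵥ fun j : J => e i j)) +
      (fun j : J => e i j) ⬝ᵥ (wproj (ZJ J X) (Sig i) *ᵥ fun j : J => e i j) := fun i => by
    have h1 : (fun j : J => e i j) ⬝ᵥ (wproj (ZJ J X) (Sig i) *ᵥ (Lᵀ *ᵥ a₀ i)) =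
        (Lᵀ *ᵥ a₀ i) ⬝ᵥ (wproj (ZJ J X) (Sig i) *ᵥ fun j : J => e i j) := by
      rw [dotProduct_mulVec, ← mulVec_transpose, wproj_transpose _ (hsymm i), dotProduct_comm]
    rw [mulVec_add, add_dotProduct, dotProduct_add, dotProduct_add, h1]
    ring
  simp_rw [hexp]
  rw [Finset.sum_add_distrib, Finset.sum_add_distrib, ← Finset.mul_sum]
  simp only [transpose_zero, zero_mulVec, zero_add]
  have h1 := abs_le.mp (hquad X hX)
  have h2 := abs_le.mp (hquad X₀ hX₀)
  have h3 := abs_le.mp hcross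
  linarith [h1.1, h2.2, h3.1]

attribute [local instance] Matrix.normedAddCommGroup Matrix.normedSpace

/-- In `X - X₀ = L Z_J` the entries of `Z_J` grow at most like `z + D`, where `D = ‖X - X₀‖`. Hence
`D / (z + D) ≤ N * ℓ`, and the left side increases in `D`. -/
lemma exists_deviation_lower_bound (J : Finset (Fin n ⊕ Fin d)) (X₀ : Matrix (Fin n) (Fin d) ℝ)
    {ε : ℝ} (hε : 0 < ε) :
    ∃ c : ℝ, 0 < c ∧ ∀ X : Matrix (Fin n) (Fin d) ℝ, (ZJ J X).rank = d → ε < dist X X₀ →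
      ∀ ℓ : ℝ, (∀ k b, |deviation J X₀ X k b| ≤ ℓ) → 0 ≤ ℓ → c ≤ ℓ := by
  set z : ℝ := ‖X₀‖ + 1 with hz
  have hz0 : 0 < z := by positivity
  set N : ℝ := J.card + 1 with hN
  have hN0 : 0 < N := by positivity
  -- The value of `D / (N * (z + D))` at `D = ε`; taking `N = card J + 1` keeps it meaningful for
  -- empty `J`.
  refine ⟨ε / (N * (z + ε)), by positivity, fun X hX hdist ℓ hℓ hℓ0 => ?_⟩
  rw [dist_eq_norm] at hdist
  set D := ‖X - X₀‖ with hD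
  have hZ : ∀ (b : J) j, |ZJ J X b j| ≤ z + D := fun b j => by
    obtain ⟨b, hb⟩ := b
    simp only [ZJ, submatrix_apply, id]
    rcases b with k | k
    · have h1 : X k j = X₀ k j + (X - X₀) k j := by simp
      have h2 : |X₀ k j| ≤ ‖X₀‖ := Matrix.norm_entry_le_entrywise_sup_norm X₀
      have h3 : |(X - X₀) k j| ≤ D := Matrix.norm_entry_le_entrywise_sup_norm (X - X₀)
      change |X k j| ≤ _
      rw [h1]
      refine (abs_add_le _ _).trans ?_
      linarith
    · change |(-1 : Matrix (Fin d) (Fin d) ℝ) k j| ≤ _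
      have h1 : |(-1 : Matrix (Fin d) (Fin d) ℝ) k j| ≤ 1 := by
        rw [Matrix.neg_apply, abs_neg, Matrix.one_apply]
        split_ifs <;> simp
      have : 0 ≤ ‖X₀‖ := norm_nonneg _
      have : 0 ≤ D := norm_nonneg _
      linarith
  have hDle : D ≤ J.card * (ℓ * (z + D)) := by
    rw [hD, Matrix.norm_le_iff (by positivity)]
    intro k j
    have h1 := congrFun (congrFun (deviation_mul_ZJ (X₀ := X₀) hX) k) j
    rw [← h1, Matrix.mul_apply, Real.norm_eq_abs]
    refine (Finset.abs_sum_le_sum_abs _ _).trans ?_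
    calc ∑ b : J, |deviation J X₀ X k b * ZJ J X b j| ≤ ∑ _b : J, ℓ * (z + D) := by
          refine Finset.sum_le_sum fun b _ => ?_
          rw [abs_mul]
          exact mul_le_mul (hℓ k b) (hZ b j) (abs_nonneg _) hℓ0
      _ = _ := by simp [hD]
  have hDN : D ≤ N * ℓ * (z + D) := by
    have : 0 ≤ ℓ * (z + D) := by positivity
    nlinarith
  rw [div_le_iff₀ (by positivity)]
  by_contra! hlt
  have h1 : N * ℓ < 1 := by nlinarith
  nlinarith

end LowerBound

/-! ### Probabilistic estimates. -/

section Probability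

open Matrix

variable {Ω : Type*} [MeasurableSpace Ω] {μ : Measure Ω} [IsProbabilityMeasure μ]

/-- Markov's inequality for the majorant `Φ` of `exists_uniform_bound`: the bad event has measure at
most a constant times `r m / lam m`, and a single event serves all `Z`. -/
lemma exists_bad_event {ι : Type*} [Fintype ι] [DecidableEq ι]
    {Sig : ℕ → Matrix ι ι ℝ} (hpd : ∀ i, (Sig i).PosDef) {k : ℝ}
    (hk : 0 < k) (hlow : ∀ i (x : ι → ℝ), k * (x ⬝ᵥ x) ≤ x ⬝ᵥ (Sig i *ᵥ x)) {K : ℝ}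
    (hK : ∀ i a b, |Sig i a b| ≤ K) (p : Type*) [Fintype p] [DecidableEq p]
    {ξ : ℕ → Ω → ℝ} (hmeas : ∀ i, Measurable (ξ i)) (hL2 : ∀ i, MemLp (ξ i) 2 μ)
    (hmean : ∀ i, ∫ ω, ξ i ω ∂μ = 0) (hind : Pairwise fun i j => IndepFun (ξ i) (ξ j) μ)
    {lam r : ℕ → ℝ} (hlam : ∀ᶠ m in atTop, 0 < lam m)
    (hr : ∀ m, √(∑ i ∈ Finset.range m, ∫ ω, ξ i ω ^ 2 ∂μ) ≤ r m)
    (hlim : Tendsto (fun m => r m / lam m) atTop (𝓝 0)) {c : ℝ} (hc : 0 < c) :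
    ∃ E : ℕ → Set Ω, Tendsto (fun m => μ (E m)) atTop (𝓝 0) ∧
      ∀ m, 0 < lam m → ∀ ω ∉ E m, ∀ Z : Matrix ι p ℝ, Z.rank = Fintype.card p → ∀ a b,
        |∑ i ∈ Finset.range m, ξ i ω * wproj Z (Sig i) a b| ≤ c * lam m := by
  obtain ⟨C, hC, hub⟩ := exists_uniform_bound (μ := μ) hpd hk hlow hK p
  choose Φ hΦm hΦint hΦ using fun m => hub m ξ hmeas hL2 hmean hind
  refine ⟨fun m => {ω | ENNReal.ofReal (c * lam m) ≤ Φ m ω}, ?_, fun m hm ω hω Z hZ a b => ?_⟩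
  · have hup : Tendsto (fun m => ENNReal.ofReal (C / c * (r m / lam m))) atTop (𝓝 0) := by
      have h1 := hlim.const_mul (C / c)
      simpa [Function.comp_def] using (ENNReal.continuous_ofReal.tendsto _).comp h1
    refine tendsto_of_tendsto_of_tendsto_of_le_of_le' tendsto_const_nhds hup
      (Eventually.of_forall fun _ => zero_le) ?_
    filter_upwards [hlam] with m hm
    have hpos : 0 < c * lam m := mul_pos hc hm
    refine (meas_ge_le_lintegral_div (hΦm m).aemeasurable (by simpa using hpos)
      ENNReal.ofReal_ne_top).trans ?_
    refine (ENNReal.div_le_div_right (hΦint m) _).trans ?_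
    rw [← ENNReal.ofReal_div_of_pos hpos]
    refine ENNReal.ofReal_le_ofReal ?_
    rw [div_mul_div_comm]
    gcongr
    exact hr m
  · have h1 := (hΦ m ω Z hZ a b).trans (not_le.mp hω).le
    exact (ENNReal.ofReal_le_ofReal_iff (mul_pos hc hm).le).mp h1

lemma tendsto_measure_iUnion {κ : Type*} [Fintype κ] {E : κ → ℕ → Set Ω}
    (h : ∀ i, Tendsto (fun m => μ (E i m)) atTop (𝓝 0)) :
    Tendsto (fun m => μ (⋃ i, E i m)) atTop (𝓝 0) := by
  have h1 : Tendsto (fun m => ∑ i, μ (E i m)) atTop (𝓝 (∑ _i : κ, 0)) :=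
    tendsto_finsetSum _ fun i _ => h i
  rw [Finset.sum_const_zero] at h1
  exact tendsto_of_tendsto_of_tendsto_of_le_of_le tendsto_const_nhds h1 (fun _ => zero_le)
    fun m => measure_iUnion_fintype_le μ fun i => E i m

/-- Transfers the uniform bound on moments of order `2 * r ≥ 4` to fourth moments. -/
lemma enorm_pow_four_le {r : ℝ} (hr : 2 ≤ r) (x : ℝ) :
    ‖x ^ 4‖ₑ ≤ 1 + ‖x‖ₑ ^ (2 * r) := by
  rw [enorm_pow]
  rcases le_total ‖x‖ₑ 1 with h | h
  · exact (pow_le_one₀ zero_le h).trans le_self_add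
  · refine le_trans ?_ le_add_self
    rw [← ENNReal.rpow_natCast]
    exact ENNReal.rpow_le_rpow_of_exponent_le h (by push_cast; linarith)

lemma integrable_pow_four {f : Ω → ℝ} (hf : Measurable f) {r : ℝ} (hr : 2 ≤ r) {B : ENNReal}
    (hB : B ≠ ⊤) (h : ∫⁻ ω, ‖f ω‖ₑ ^ (2 * r) ∂μ ≤ B) :
    Integrable (fun ω => f ω ^ 4) μ ∧ ∫ ω, f ω ^ 4 ∂μ ≤ 1 + B.toReal := by
  have h1 : ∫⁻ ω, ‖f ω ^ 4‖ₑ ∂μ ≤ 1 + B := by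
    calc ∫⁻ ω, ‖f ω ^ 4‖ₑ ∂μ ≤ ∫⁻ ω, (1 + ‖f ω‖ₑ ^ (2 * r)) ∂μ :=
          lintegral_mono fun ω => enorm_pow_four_le hr _
      _ = 1 + ∫⁻ ω, ‖f ω‖ₑ ^ (2 * r) ∂μ := by
          rw [lintegral_add_left measurable_const]
          simp
      _ ≤ 1 + B := by gcongr
  have hfin : (1 + B) ≠ ⊤ := by simp [hB]
  refine ⟨⟨(hf.pow_const 4).aestronglyMeasurable, lt_of_le_of_lt h1 hfin.lt_top⟩, ?_⟩
  rw [integral_eq_lintegral_of_nonneg_ae (ae_of_all _ fun ω => by positivity)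
    (hf.pow_const 4).aestronglyMeasurable]
  have h2 : ∀ ω, ENNReal.ofReal (f ω ^ 4) = ‖f ω ^ 4‖ₑ := fun ω => by
    rw [Real.enorm_eq_ofReal (by positivity)]
  simp_rw [h2]
  refine (ENNReal.toReal_mono hfin h1).trans ?_
  rw [ENNReal.toReal_add (by simp) hB]
  simp

lemma integral_sq_le {f : Ω → ℝ}
    (h4 : Integrable (fun ω => f ω ^ 4) μ) {M : ℝ} (hM : ∫ ω, f ω ^ 4 ∂μ ≤ M) :
    ∫ ω, f ω ^ 2 ∂μ ≤ 1 + M := by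
  have hpt : ∀ ω, f ω ^ 2 ≤ 1 + f ω ^ 4 := fun ω => by nlinarith [sq_nonneg (f ω ^ 2 - 1)]
  calc ∫ ω, f ω ^ 2 ∂μ ≤ ∫ ω, (1 + f ω ^ 4) ∂μ :=
        integral_mono_of_nonneg (ae_of_all _ fun ω => sq_nonneg _)
          ((integrable_const 1).add h4) (ae_of_all _ hpt)
    _ = 1 + ∫ ω, f ω ^ 4 ∂μ := by
        rw [integral_add (integrable_const 1) h4]
        simp
    _ ≤ 1 + M := by gcongr

lemma memLp_mul_of_pow_four {f g : Ω → ℝ} (hf : Measurable f) (hg : Measurable g)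
    (hf4 : Integrable (fun ω => f ω ^ 4) μ) (hg4 : Integrable (fun ω => g ω ^ 4) μ) {M : ℝ}
    (hfM : ∫ ω, f ω ^ 4 ∂μ ≤ M) (hgM : ∫ ω, g ω ^ 4 ∂μ ≤ M) :
    MemLp (fun ω => f ω * g ω) 2 μ ∧ ∫ ω, (f ω * g ω) ^ 2 ∂μ ≤ M := by
  have hpt : ∀ ω, (f ω * g ω) ^ 2 ≤ (f ω ^ 4 + g ω ^ 4) / 2 := fun ω => by
    nlinarith [sq_nonneg (f ω ^ 2 - g ω ^ 2)]
  have hint : Integrable (fun ω => (f ω ^ 4 + g ω ^ 4) / 2) μ := (hf4.add hg4).div_const 2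
  refine ⟨(memLp_two_iff_integrable_sq (hf.mul hg).aestronglyMeasurable).mpr ?_, ?_⟩
  · refine hint.mono' ((hf.mul hg).pow_const 2).aestronglyMeasurable (ae_of_all _ fun ω => ?_)
    rw [Real.norm_eq_abs, abs_of_nonneg (sq_nonneg _)]
    exact hpt ω
  · calc ∫ ω, (f ω * g ω) ^ 2 ∂μ ≤ ∫ ω, (f ω ^ 4 + g ω ^ 4) / 2 ∂μ :=
          integral_mono_of_nonneg (ae_of_all _ fun ω => sq_nonneg _) hint (ae_of_all _ hpt)
      _ = (∫ ω, f ω ^ 4 ∂μ + ∫ ω, g ω ^ 4 ∂μ) / 2 := by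
          rw [integral_div, integral_add hf4 hg4]
      _ ≤ M := by linarith

lemma dotProduct_mulVec_le_of_abs_le {ι : Type*} [Fintype ι] {S : Matrix ι ι ℝ} {K : ℝ}
    (hK : ∀ a b, |S a b| ≤ K) (x : ι → ℝ) :
    x ⬝ᵥ (S *ᵥ x) ≤ Fintype.card ι * K * (x ⬝ᵥ x) := by
  have h1 : ∀ a b, x a * (S a b * x b) ≤ K * ((x a * x a + x b * x b) / 2) := fun a b => by
    have hK0 : 0 ≤ K := (abs_nonneg _).trans (hK a b)
    calc x a * (S a b * x b) = S a b * (x a * x b) := by ring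
      _ ≤ |S a b * (x a * x b)| := le_abs_self _
      _ = |S a b| * |x a * x b| := abs_mul _ _
      _ ≤ K * ((x a * x a + x b * x b) / 2) := by
          refine mul_le_mul (hK a b) ?_ (abs_nonneg _) hK0
          rw [abs_le]
          constructor <;> nlinarith [sq_nonneg (x a + x b), sq_nonneg (x a - x b)]
  calc x ⬝ᵥ (S *ᵥ x) = ∑ a, ∑ b, x a * (S a b * x b) := by
        simp only [dotProduct, mulVec, Finset.mul_sum]
    _ ≤ ∑ a, ∑ b, K * ((x a * x a + x b * x b) / 2) :=
        Finset.sum_le_sum fun a _ => Finset.sum_le_sum fun b _ => h1 a b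
    _ = Fintype.card ι * K * (x ⬝ᵥ x) := by
        have h2 : ∀ a, ∑ b, K * ((x a * x a + x b * x b) / 2) =
            K / 2 * (Fintype.card ι * (x a * x a) + x ⬝ᵥ x) := fun a => by
          rw [← Finset.mul_sum, ← Finset.sum_div, Finset.sum_add_distrib, Finset.sum_const,
            Finset.card_univ, nsmul_eq_mul, dotProduct]
          ring
        simp_rw [h2]
        rw [← Finset.mul_sum, Finset.sum_add_distrib, ← Finset.mul_sum, Finset.sum_const,
          Finset.card_univ, nsmul_eq_mul, dotProduct]
        ring

lemma posDef_of_forall_le {ι : Type*} [Fintype ι] [DecidableEq ι] {S : Matrix ι ι ℝ}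
    (hS : Sᵀ = S) {k : ℝ} (hk : 0 < k) (hlow : ∀ x : ι → ℝ, k * (x ⬝ᵥ x) ≤ x ⬝ᵥ (S *ᵥ x)) :
    S.PosDef := by
  refine PosDef.of_dotProduct_mulVec_pos (by simpa [Matrix.IsHermitian] using hS) fun x hx => ?_
  rw [star_trivial]
  refine lt_of_lt_of_le (mul_pos hk ?_) (hlow x)
  refine lt_of_le_of_ne (Finset.sum_nonneg fun i _ => mul_self_nonneg _) fun h => hx ?_
  exact dotProduct_self_eq_zero.mp h.symm

lemma tendsto_sqrt_div {lam Lam : ℕ → ℝ} (hlam : ∀ᶠ m in atTop, 0 < lam m)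
    (h : Tendsto (fun m => lam m ^ 2 / Lam m) atTop atTop) (M : ℝ) :
    Tendsto (fun m => √(M * Lam m) / lam m) atTop (𝓝 0) := by
  have h1 : Tendsto (fun m => √(M * (lam m ^ 2 / Lam m)⁻¹)) atTop (𝓝 0) := by
    have := (h.inv_tendsto_atTop.const_mul M).sqrt
    simpa using this
  refine h1.congr' ?_
  filter_upwards [hlam] with m hm
  rw [inv_div, ← mul_div_assoc, Real.sqrt_div' _ (sq_nonneg _), Real.sqrt_sq hm.le]

end Probability

/-! ### Unbiasedness of the estimating function. -/

section Unbiased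

open Matrix

variable {n d : ℕ} {Ω : Type*} [MeasurableSpace Ω] {μ : Measure Ω}

lemma s_eq_mul (u : Fin n → ℝ) (v : Fin d → ℝ)
    (S : Matrix (Fin n ⊕ Fin d) (Fin n ⊕ Fin d) ℝ) (X : Matrix (Fin n) (Fin d) ℝ)
    {t : Fin d → ℝ} (ht : (Zmat X)ᵀ *ᵥ (Sum.elim u v) = t) :
    s u v S X = (vecMulVec u t -
      S.toRows₁ * Zmat X * ((Zmat X)ᵀ * S * Zmat X)⁻¹ * vecMulVec t t) *
        ((Zmat X)ᵀ * S * Zmat X)⁻¹ := by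
  have h1 : Sum.elim u v ᵥ* Zmat X = t := by rw [← mulVec_transpose, ht]
  rw [s, sTilde, vecMulVec_mul, h1, Matrix.mul_assoc _ (vecMulVec _ _), vecMulVec_mul, h1,
    Matrix.mul_assoc _ (Zmat X)ᵀ, mul_vecMulVec (Zmat X)ᵀ, ht]

/-- The estimating function is unbiased at the true parameter. -/
theorem integral_s_eq_zero {X₀ : Matrix (Fin n) (Fin d) ℝ} (a₀ : Fin n → ℝ)
    {e : Ω → Fin n ⊕ Fin d → ℝ} [IsProbabilityMeasure μ]
    (hL2 : ∀ j, MemLp (fun ω => e ω j) 2 μ) (hmean : ∀ j, ∫ ω, e ω j ∂μ = 0)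
    {S : Matrix (Fin n ⊕ Fin d) (Fin n ⊕ Fin d) ℝ} {v : ℝ}
    (hS : ∀ j k, ∫ ω, e ω j * e ω k ∂μ = v * S j k)
    (hdet : IsUnit ((Zmat X₀)ᵀ * S * Zmat X₀).det) (k : Fin n) (l : Fin d) :
    Integrable (fun ω => s (fun i => obsRow X₀ a₀ (e ω) (Sum.inl i))
        (fun i => obsRow X₀ a₀ (e ω) (Sum.inr i)) S X₀ k l) μ ∧
      ∫ ω, s (fun i => obsRow X₀ a₀ (e ω) (Sum.inl i))
        (fun i => obsRow X₀ a₀ (e ω) (Sum.inr i)) S X₀ k l ∂μ = 0 := by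
  set Z := Zmat X₀ with hZ
  set M := Zᵀ * S * Z with hM
  set t : Ω → Fin d → ℝ := fun ω => Zᵀ *ᵥ e ω with ht
  set G := S.toRows₁ * Z * M⁻¹ with hG
  have hee : ∀ i j, Integrable (fun ω => e ω i * e ω j) μ := fun i j =>
    (hL2 i).integrable_mul (hL2 j)
  have he : ∀ i, Integrable (fun ω => e ω i) μ := fun i => (hL2 i).integrable (by norm_num)
  -- At the true parameter `Zᵀ` annihilates the true row, leaving only the error.
  have hZt : ∀ ω, Zᵀ *ᵥ Sum.elim (fun i => obsRow X₀ a₀ (e ω) (Sum.inl i))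
      (fun i => obsRow X₀ a₀ (e ω) (Sum.inr i)) = t ω := fun ω => by
    have h1 : (Sum.elim (fun i => obsRow X₀ a₀ (e ω) (Sum.inl i))
        (fun i => obsRow X₀ a₀ (e ω) (Sum.inr i)) : Fin n ⊕ Fin d → ℝ) = trueRow X₀ a₀ + e ω := by
      ext j; rcases j with j | j <;> rfl
    rw [h1, mulVec_add, hZ, Zmat_transpose_mulVec X₀ (trueRow X₀ a₀)]
    simp [trueRow, ht, hZ]
  have hseq : ∀ ω, s (fun i => obsRow X₀ a₀ (e ω) (Sum.inl i))
        (fun i => obsRow X₀ a₀ (e ω) (Sum.inr i)) S X₀ k l =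
      ∑ q, ((a₀ k + e ω (Sum.inl k)) * t ω q - ∑ j, G k j * (t ω j * t ω q)) * M⁻¹ q l :=
    fun ω => by
      rw [s_eq_mul _ _ _ _ (hZt ω), Matrix.mul_apply]
      rfl
  have hat : ∀ q, Integrable (fun ω => (a₀ k + e ω (Sum.inl k)) * t ω q) μ ∧
      ∫ ω, (a₀ k + e ω (Sum.inl k)) * t ω q ∂μ = v * (S.toRows₁ * Z) k q := fun q => by
    have h1 : ∀ ω, (a₀ k + e ω (Sum.inl k)) * t ω q =
        ∑ p, (Z p q * a₀ k * e ω p + Z p q * (e ω (Sum.inl k) * e ω p)) := fun ω => by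
      simp only [ht, mulVec, dotProduct, transpose_apply, Finset.mul_sum]
      exact Finset.sum_congr rfl fun p _ => by ring
    have h2 : ∀ p, Integrable
        (fun ω => Z p q * a₀ k * e ω p + Z p q * (e ω (Sum.inl k) * e ω p)) μ := fun p =>
      ((he p).const_mul _).add ((hee _ p).const_mul _)
    simp_rw [h1]
    refine ⟨integrable_finsetSum _ fun p _ => h2 p, ?_⟩
    rw [integral_finsetSum _ fun p _ => h2 p, Matrix.mul_apply, Finset.mul_sum]
    refine Finset.sum_congr rfl fun p _ => ?_
    rw [integral_add ((he p).const_mul _) ((hee _ p).const_mul _), integral_const_mul,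
      integral_const_mul, hmean, hS, toRows₁_apply]
    ring
  have htt : ∀ j q, Integrable (fun ω => t ω j * t ω q) μ ∧
      ∫ ω, t ω j * t ω q ∂μ = v * M j q := fun j q => by
    have h1 : ∀ ω, t ω j * t ω q = ∑ p', ∑ p, Z p j * Z p' q * (e ω p * e ω p') := fun ω => by
      simp only [ht, mulVec, dotProduct, transpose_apply, Finset.sum_mul_sum]
      rw [Finset.sum_comm]
      exact Finset.sum_congr rfl fun p _ => Finset.sum_congr rfl fun p' _ => by ring
    have h2 : ∀ p' p, Integrable (fun ω => Z p j * Z p' q * (e ω p * e ω p')) μ := fun p' p =>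
      (hee p p').const_mul _
    simp_rw [h1]
    refine ⟨integrable_finsetSum _ fun p' _ => integrable_finsetSum _ fun p _ => h2 p' p, ?_⟩
    rw [integral_finsetSum _ fun p' _ => integrable_finsetSum _ fun p _ => h2 p' p, hM,
      Matrix.mul_apply, Finset.mul_sum]
    refine Finset.sum_congr rfl fun p' _ => ?_
    rw [integral_finsetSum _ fun p _ => h2 p' p, Matrix.mul_apply, Finset.sum_mul, Finset.mul_sum]
    refine Finset.sum_congr rfl fun p _ => ?_
    rw [integral_const_mul, hS, transpose_apply]
    ring
  have hterm : ∀ q, Integrable (fun ω =>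
      ((a₀ k + e ω (Sum.inl k)) * t ω q - ∑ j, G k j * (t ω j * t ω q)) * M⁻¹ q l) μ := fun q =>
    ((hat q).1.sub (integrable_finsetSum _ fun j _ => (htt j q).1.const_mul _)).mul_const _
  simp_rw [hseq]
  refine ⟨integrable_finsetSum _ fun q _ => hterm q, ?_⟩
  rw [integral_finsetSum _ fun q _ => hterm q]
  refine Finset.sum_eq_zero fun q _ => ?_
  rw [integral_mul_const, integral_sub (hat q).1
    (integrable_finsetSum _ fun j _ => (htt j q).1.const_mul _), (hat q).2,
    integral_finsetSum _ fun j _ => (htt j q).1.const_mul _]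
  simp_rw [integral_const_mul, fun j => (htt j q).2]
  -- `G` is the regression coefficient: it matches `E[a tᵀ] = v S_rows Z` with `G E[t tᵀ] = v G M`.
  have h1 : (G * M) k q = (S.toRows₁ * Z) k q := by
    rw [hG, Matrix.mul_assoc, Matrix.nonsing_inv_mul _ hdet, Matrix.mul_one]
  rw [← h1, Matrix.mul_apply, Finset.mul_sum, ← Finset.sum_sub_distrib]
  rw [Finset.sum_eq_zero fun j _ => by ring, zero_mul]

end Unbiased

/-! ### Existence of a solution with probability tending to one. -/

section Consistency

open Matrix

variable {n d : ℕ} {Ω : Type*} [MeasurableSpace Ω] {μ : Measure Ω} [IsProbabilityMeasure μ]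

lemma indepFun_comp_pair {α β : Type*} [MeasurableSpace α] {X : ℕ → Ω → α} [MeasurableSpace β]
    (h : iIndepFun X μ) {g : ℕ → α → β} (hg : ∀ i, Measurable (g i)) :
    Pairwise fun i j => IndepFun (fun ω => g i (X i ω)) (fun ω => g j (X j ω)) μ :=
  fun _ _ hij => (h.indepFun hij).comp (hg _) (hg _)

lemma abs_integral_le_of_integral_sq_le {f : Ω → ℝ} (hf : MemLp f 2 μ) {M : ℝ} (hM0 : 0 ≤ M)
    (hM : ∫ ω, f ω ^ 2 ∂μ ≤ M) : |∫ ω, f ω ∂μ| ≤ 1 + M := by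
  have h1 := variance_nonneg f μ
  rw [variance_eq_sub hf] at h1
  have h2 : ∫ ω, (f ^ 2) ω ∂μ = ∫ ω, f ω ^ 2 ∂μ := rfl
  rw [h2] at h1
  refine abs_le_of_sq_le_sq ?_ (by linarith)
  nlinarith

/-- With probability tending to one the problem has a solution. -/
theorem exists_bad_event_isSolution {X₀ : Matrix (Fin n) (Fin d) ℝ} {a₀ : ℕ → Fin n → ℝ}
    {err : ℕ → Ω → Fin n ⊕ Fin d → ℝ} (herr : ∀ i, Measurable (err i)) (h_indep : iIndepFun err μ)
    (h_sq : ∀ i j, MemLp (fun ω => err i ω j) 2 μ) (h_mean : ∀ i j, ∫ ω, err i ω j ∂μ = 0)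
    {J : Finset (Fin n ⊕ Fin d)} (h_free : ∀ i, ∀ j ∉ J, ∀ᵐ ω ∂μ, err i ω j = 0)
    {v : ℝ} (hv : 0 < v) {Sig : ℕ → Matrix J J ℝ}
    (h_cov : ∀ i (a b : J), ∫ ω, err i ω a * err i ω b ∂μ = v * Sig i a b)
    (hpd : ∀ i, (Sig i).PosDef) {k : ℝ} (hk : 0 < k)
    (hlow : ∀ i (x : J → ℝ), k * (x ⬝ᵥ x) ≤ x ⬝ᵥ (Sig i *ᵥ x))
    (h_rank : (ZJ J X₀).rank = d) {M : ℝ} (hM0 : 0 ≤ M)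
    (h4 : ∀ i (j : J), Integrable (fun ω => err i ω j ^ 4) μ)
    (h4M : ∀ i (j : J), ∫ ω, err i ω j ^ 4 ∂μ ≤ M)
    (h_vi : Tendsto (fun m : ℕ =>
      lambdaMin ((inputMat a₀ m)ᵀ * inputMat a₀ m) / √(m : ℝ)) atTop atTop)
    (h_vii : Tendsto (fun m : ℕ =>
      lambdaMin ((inputMat a₀ m)ᵀ * inputMat a₀ m) ^ 2 /
        lambdaMax ((inputMat a₀ m)ᵀ * inputMat a₀ m)) atTop atTop)
    {S : ℕ → Matrix (Fin n ⊕ Fin d) (Fin n ⊕ Fin d) ℝ} (hS : ∀ i, (S i)ᵀ = S i)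
    (hg : ∀ i X, (Zmat X)ᵀ * S i * Zmat X = (ZJ J X)ᵀ * Sig i * ZJ J X) :
    ∃ E : ℕ → Set Ω, Tendsto (fun m => μ (E m)) atTop (𝓝 0) ∧
      ∀ᶠ m in atTop, ∀ ω ∉ E m, ∃ X, IsSolution J (fun i : Fin m => Sig i)
        (dataMat X₀ a₀ (fun i => err i ω) m) X := by
  have hmj : ∀ i j, Measurable fun ω => err i ω j := fun i j => (measurable_pi_apply j).comp (herr i)
  have hprod := fun i (a b : J) => memLp_mul_of_pow_four (hmj i a) (hmj i b) (h4 i a) (h4 i b)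
    (h4M i a) (h4M i b)
  -- An upper bound for the `Sig i` is not assumed; it follows from the fourth moments, because `v *
  -- Sig i a b` is a mean of products of errors.
  set K₀ : ℝ := (1 + M) / v with hK₀def
  have hK₀ : ∀ i a b, |Sig i a b| ≤ K₀ := fun i a b => by
    have h1 := abs_integral_le_of_integral_sq_le (hprod i a b).1 hM0 (hprod i a b).2
    rw [h_cov, abs_mul, abs_of_pos hv] at h1
    rw [hK₀def, le_div_iff₀ hv, mul_comm]
    exact h1
  have hK₀0 : 0 ≤ K₀ := by positivity
  set K : ℝ := Fintype.card J * K₀ + 1 with hKdef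
  have hK : 0 < K := by positivity
  have hup : ∀ i (x : J → ℝ), x ⬝ᵥ (Sig i *ᵥ x) ≤ K * (x ⬝ᵥ x) := fun i x => by
    refine (dotProduct_mulVec_le_of_abs_le (hK₀ i) x).trans ?_
    have : 0 ≤ x ⬝ᵥ x := Finset.sum_nonneg fun i _ => mul_self_nonneg _
    nlinarith
  set lam : ℕ → ℝ := fun m => lambdaMin ((inputMat a₀ m)ᵀ * inputMat a₀ m) with hlamdef
  set Lam : ℕ → ℝ := fun m => lambdaMax ((inputMat a₀ m)ᵀ * inputMat a₀ m) with hLamdef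
  have hlam : ∀ᶠ m in atTop, 0 < lam m := by
    filter_upwards [h_vi.eventually_gt_atTop 0] with m hm
    by_contra! h
    exact absurd hm (not_lt.mpr (div_nonpos_of_nonpos_of_nonneg h (Real.sqrt_nonneg _)))
  obtain ⟨ε, hε, hball⟩ := exists_closedBall_rank_eq h_rank
  obtain ⟨c, hc, hdev⟩ := exists_deviation_lower_bound J X₀ hε
  -- With `c₁` and `c₂` so chosen, the cross term and the centred quadratic noise each cost at most
  -- half of the signal whenever `c ≤ ℓ`.
  set c₁ : ℝ := K⁻¹ * c / (4 * (n * J.card ^ 2 + 1)) with hc₁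
  set c₂ : ℝ := K⁻¹ * c ^ 2 / (4 * ((J.card : ℝ) ^ 2 + 1)) with hc₂
  have hc₁0 : 0 < c₁ := by positivity
  have hc₂0 : 0 < c₂ := by positivity
  have hcross : ∀ kb : Fin n × J, ∃ E : ℕ → Set Ω, Tendsto (fun m => μ (E m)) atTop (𝓝 0) ∧
      ∀ m, 0 < lam m → ∀ ω ∉ E m, ∀ Z : Matrix J (Fin d) ℝ, Z.rank = Fintype.card (Fin d) →
        ∀ a b, |∑ i ∈ Finset.range m, (a₀ i kb.1 * err i ω kb.2) * wproj Z (Sig i) a b| ≤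
          c₁ * lam m := fun ⟨k', b'⟩ => by
    refine exists_bad_event (r := fun m => √((1 + M) * Lam m)) hpd hk hlow hK₀ (Fin d)
      (fun i => (hmj i b').const_mul (a₀ i k')) (fun i => (h_sq i b').const_mul (a₀ i k'))
      (fun i => by rw [integral_const_mul, h_mean, mul_zero])
      (indepFun_comp_pair h_indep (g := fun i x => a₀ i k' * x b')
        fun i => (measurable_pi_apply _).const_mul _) hlam (fun m => ?_)
      (tendsto_sqrt_div hlam h_vii _) hc₁0
    refine Real.sqrt_le_sqrt ?_
    -- A diagonal entry of `A₀ᵀA₀` is at most its largest eigenvalue, so the cross term has order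
    -- `√Lam`, which (vii) controls.
    have h1 : ∑ i ∈ Finset.range m, a₀ i k' ^ 2 ≤ Lam m := by
      have h2 := diag_le_lambdaMax (isHermitian_gram_inputMat a₀ m) k'
      rw [Matrix.mul_apply] at h2
      rw [Finset.sum_range]
      refine le_trans (le_of_eq ?_) h2
      simp [inputMat, sq]
    calc ∑ i ∈ Finset.range m, ∫ ω, (a₀ i k' * err i ω b') ^ 2 ∂μ
        ≤ ∑ i ∈ Finset.range m, (1 + M) * a₀ i k' ^ 2 := by
          refine Finset.sum_le_sum fun i _ => ?_
          simp only [mul_pow]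
          rw [integral_const_mul, mul_comm]
          exact mul_le_mul_of_nonneg_right (integral_sq_le (h4 i b') (h4M i b')) (sq_nonneg _)
      _ = (1 + M) * ∑ i ∈ Finset.range m, a₀ i k' ^ 2 := by rw [Finset.mul_sum]
      _ ≤ (1 + M) * Lam m := by gcongr
  have hquad : ∀ ab : J × J, ∃ E : ℕ → Set Ω, Tendsto (fun m => μ (E m)) atTop (𝓝 0) ∧
      ∀ m, 0 < lam m → ∀ ω ∉ E m, ∀ Z : Matrix J (Fin d) ℝ, Z.rank = Fintype.card (Fin d) →
        ∀ a b, |∑ i ∈ Finset.range m, (err i ω ab.1 * err i ω ab.2 - v * Sig i ab.1 ab.2) *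
          wproj Z (Sig i) a b| ≤ c₂ * lam m := fun ⟨a', b'⟩ => by
    refine exists_bad_event (r := fun m => √(M * m))
      (ξ := fun i ω => err i ω a' * err i ω b' - v * Sig i a' b') hpd hk hlow hK₀ (Fin d)
      (fun i => ((hmj i a').mul (hmj i b')).sub_const (v * Sig i a' b'))
      (fun i => (hprod i a' b').1.sub (memLp_const (v * Sig i a' b'))) (fun i => ?_)
      (indepFun_comp_pair h_indep (g := fun i x => x a' * x b' - v * Sig i a' b')
        fun i => (show Measurable fun x : Fin n ⊕ Fin d → ℝ => x a' * x b' from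
          (measurable_pi_apply _).mul (measurable_pi_apply _)).sub_const _)
      hlam (fun m => ?_) ?_ hc₂0
    · rw [integral_sub ((hprod i a' b').1.integrable (by norm_num)) (integrable_const _), h_cov]
      simp
    · refine Real.sqrt_le_sqrt ?_
      calc ∑ i ∈ Finset.range m, ∫ ω, (err i ω a' * err i ω b' - v * Sig i a' b') ^ 2 ∂μ
          ≤ ∑ _i ∈ Finset.range m, M := by
            refine Finset.sum_le_sum fun i _ => le_trans ?_ (hprod i a' b').2
            -- Centring does not increase the second moment; the quadratic noise has order `√m`,
            -- which (vi) controls.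
            have h1 := variance_le_expectation_sq (X := fun ω => err i ω a' * err i ω b') (μ := μ)
              (hprod i a' b').1.aestronglyMeasurable
            rw [variance_eq_integral (hprod i a' b').1.aemeasurable, h_cov] at h1
            exact h1
        _ = M * m := by simp [mul_comm]
    · have h1 : Tendsto (fun m : ℕ => √M * (lam m / √(m : ℝ))⁻¹) atTop (𝓝 0) := by
        simpa using h_vi.inv_tendsto_atTop.const_mul (√M)
      refine h1.congr fun m => ?_
      rw [Real.sqrt_mul hM0, inv_div, mul_div_assoc]
  choose E₁ hE₁ hE₁b using hcross
  choose E₂ hE₂ hE₂b using hquad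
  -- The errors off `J` vanish only almost surely, so the exceptional set joins the bad event.
  set N : Set Ω := {ω | ¬ ∀ i, ∀ j ∉ J, err i ω j = 0} with hNdef
  have hN : μ N = 0 := by
    have h1 : ∀ᵐ ω ∂μ, ∀ i, ∀ j ∉ J, err i ω j = 0 := by
      rw [ae_all_iff]; intro i
      rw [ae_all_iff]; intro j
      by_cases hj : j ∈ J
      · exact ae_of_all _ fun ω h => absurd hj h
      · filter_upwards [h_free i j hj] with ω hω _ using hω
    exact h1
  refine ⟨fun m => (⋃ kb, E₁ kb m) ∪ (⋃ ab, E₂ ab m) ∪ N, ?_, ?_⟩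
  · have h1 := ((tendsto_measure_iUnion hE₁).add (tendsto_measure_iUnion hE₂)).add
      (tendsto_const_nhds (x := μ N))
    rw [hN, add_zero, add_zero] at h1
    refine tendsto_of_tendsto_of_tendsto_of_le_of_le tendsto_const_nhds h1 (fun _ => zero_le)
      fun m => ?_
    exact (measure_union_le _ _).trans (add_le_add (measure_union_le _ _) hN.le)
  · filter_upwards [hlam] with m hm ω hω
    simp only [Set.mem_union, Set.mem_iUnion, not_or, not_exists] at hω
    obtain ⟨⟨hω₁, hω₂⟩, hωN⟩ := hω
    have he : ∀ i, ∀ j ∉ J, err i ω j = 0 := not_not.mp hωN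
    refine exists_isSolution (c := fun i => obsRow X₀ (a₀ i) (err i ω)) hpd hS hg hε hball
      fun X hX hdist => ?_
    set q₂ : ℝ := ∑ b, ∑ k', deviation J X₀ X k' b ^ 2 with hq₂
    have hq₂0 : 0 ≤ q₂ := Finset.sum_nonneg fun b _ => Finset.sum_nonneg fun k' _ => sq_nonneg _
    have hent : ∀ k' b, |deviation J X₀ X k' b| ≤ √q₂ := fun k' b => by
      refine Real.abs_le_sqrt ?_
      refine le_trans ?_ (Finset.single_le_sum (f := fun b => ∑ k', deviation J X₀ X k' b ^ 2)
        (fun b _ => Finset.sum_nonneg fun k' _ => sq_nonneg _) (Finset.mem_univ b))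
      exact Finset.single_le_sum (f := fun k' => deviation J X₀ X k' b ^ 2)
        (fun k' _ => sq_nonneg _) (Finset.mem_univ k')
    have hcl : c ≤ √q₂ := hdev X hX hdist _ hent (Real.sqrt_nonneg _)
    have hmain := objective_sub_ge (ℓ := √q₂) (B₁ := c₁ * lam m) (B₂ := c₂ * lam m) (m := m)
      hpd hK hup h_rank hX a₀ (e := fun i => err i ω) he v
      (fun k' a b => hE₁b (k', b) m hm ω (hω₁ (k', b)) _ (by simpa using hX) a b)
      (fun Y hY a b => hE₂b (a, b) m hm ω (hω₂ (a, b)) _ (by simpa using hY) a b)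
      hent (Real.sq_sqrt hq₂0) (Real.sqrt_nonneg _)
    set ℓ := √q₂
    have hℓ : 0 < ℓ := hc.trans_le hcl
    have hKi : 0 < K⁻¹ := inv_pos.mpr hK
    have h1 : 2 * (n * (J.card : ℝ) ^ 2 * (ℓ * (c₁ * lam m))) ≤ K⁻¹ * (lam m * ℓ ^ 2) / 2 := by
      have h2 : n * (J.card : ℝ) ^ 2 * c₁ ≤ K⁻¹ * c / 4 := by
        rw [hc₁, ← mul_div_assoc, div_le_div_iff₀ (by positivity) (by norm_num)]
        have : 0 < K⁻¹ * c := by positivity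
        nlinarith
      calc 2 * (n * (J.card : ℝ) ^ 2 * (ℓ * (c₁ * lam m)))
          = 2 * (n * (J.card : ℝ) ^ 2 * c₁) * (ℓ * lam m) := by ring
        _ ≤ 2 * (K⁻¹ * c / 4) * (ℓ * lam m) := by gcongr
        _ ≤ 2 * (K⁻¹ * ℓ / 4) * (ℓ * lam m) := by gcongr
        _ = K⁻¹ * (lam m * ℓ ^ 2) / 2 := by ring
    have h3 : 2 * ((J.card : ℝ) ^ 2 * (c₂ * lam m)) ≤ K⁻¹ * (lam m * ℓ ^ 2) / 2 := by
      have h2 : (J.card : ℝ) ^ 2 * c₂ ≤ K⁻¹ * c ^ 2 / 4 := by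
        rw [hc₂, ← mul_div_assoc, div_le_div_iff₀ (by positivity) (by norm_num)]
        have : 0 < K⁻¹ * c ^ 2 := by positivity
        nlinarith
      calc 2 * ((J.card : ℝ) ^ 2 * (c₂ * lam m))
          = 2 * ((J.card : ℝ) ^ 2 * c₂) * lam m := by ring
        _ ≤ 2 * (K⁻¹ * c ^ 2 / 4) * lam m := by gcongr
        _ ≤ 2 * (K⁻¹ * ℓ ^ 2 / 4) * lam m := by gcongr
        _ = K⁻¹ * (lam m * ℓ ^ 2) / 2 := by ring
    linarith

end Consistency

end EWTLS

/-! ### The main theorem. -/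

theorem corollary4 {n d : ℕ} {Ω : Type*} [MeasurableSpace Ω] (μ : Measure Ω)
    [IsProbabilityMeasure μ]
    -- the true parameter, the nonrandom true input rows and the random error rows
    (X₀ : Matrix (Fin n) (Fin d) ℝ) (a₀ : ℕ → Fin n → ℝ)
    (err : ℕ → Ω → Fin n ⊕ Fin d → ℝ) (herr : ∀ i, Measurable (err i))
    -- (i) independent errors, zero mean, finite second moments
    (h_indep : iIndepFun err μ)
    (h_sq : ∀ i j, MemLp (fun ω => err i ω j) 2 μ)
    (h_mean : ∀ i j, ∫ ω, err i ω j ∂μ = 0)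
    -- (ii) error-free columns, covariances known up to a factor
    (J : Finset (Fin n ⊕ Fin d)) (σ : ℝ) (hσ : 0 < σ) (Sig : ℕ → Matrix J J ℝ)
    (h_free : ∀ i, ∀ j ∉ J, ∫ ω, (err i ω j) ^ 2 ∂μ = 0)
    (h_cov : ∀ i, EWTLS.covMat μ (fun ω (j : J) => err i ω j) = σ ^ 2 • Sig i)
    -- (iii)
    (h_lower : ∃ κ : ℝ, 0 < κ ∧ ∀ i, κ ^ 2 ≤ EWTLS.lambdaMin (Sig i))
    -- (iv)
    (h_rank : (EWTLS.ZJ J X₀).rank = d)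
    -- (v)
    (h_moment : ∃ r : ℝ, 2 ≤ r ∧ (d : ℝ) * ((J.card : ℝ) - ((d : ℝ) + 1) / 2) < r ∧
      (⨆ (i : ℕ) (j : J), ∫⁻ ω, ‖err i ω j‖ₑ ^ (2 * r) ∂μ) < ⊤)
    -- (vi)
    (h_vi : Tendsto (fun m : ℕ =>
      EWTLS.lambdaMin ((EWTLS.inputMat a₀ m).transpose * EWTLS.inputMat a₀ m) / √(m : ℝ))
      atTop atTop)
    -- (vii)
    (h_vii : Tendsto (fun m : ℕ =>
      EWTLS.lambdaMin ((EWTLS.inputMat a₀ m).transpose * EWTLS.inputMat a₀ m) ^ 2 /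
        EWTLS.lambdaMax ((EWTLS.inputMat a₀ m).transpose * EWTLS.inputMat a₀ m))
      atTop atTop)
    -- the matrices `Sᵢ = σ⁻² cov(c̃ᵢ)` and the observed rows `aᵢ`, `bᵢ`
    (S : ℕ → Matrix (Fin n ⊕ Fin d) (Fin n ⊕ Fin d) ℝ)
    (hS : ∀ i, S i = (1 / σ ^ 2) • EWTLS.covMat μ (err i))
    (a : ℕ → Ω → Fin n → ℝ)
    (ha : ∀ i ω k, a i ω k = EWTLS.obsRow X₀ (a₀ i) (err i ω) (Sum.inl k))
    (b : ℕ → Ω → Fin d → ℝ)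
    (hb : ∀ i ω k, b i ω k = EWTLS.obsRow X₀ (a₀ i) (err i ω) (Sum.inr k))
    -- an EW-TLS estimator for every sample size
    (est : (m : ℕ) → Matrix (Fin m) (Fin n ⊕ Fin d) ℝ → OnePoint (Matrix (Fin n) (Fin d) ℝ))
    (h_est : ∀ m, EWTLS.IsEstimator J (fun i : Fin m => Sig i) (est m)) :
    -- (a)
    Tendsto (fun m : ℕ => μ {ω | ∃ X : Matrix (Fin n) (Fin d) ℝ,
        est m (EWTLS.dataMat X₀ a₀ (fun i => err i ω) m) = (X : OnePoint _) ∧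
        (EWTLS.ZJ J X).rank = d ∧
        ∑ i ∈ Finset.range m, EWTLS.s (a i ω) (b i ω) (S i) X = 0}) atTop (𝓝 1) ∧
    -- (b)
    (∀ i k l, Integrable (fun ω => EWTLS.s (a i ω) (b i ω) (S i) X₀ k l) μ ∧
      ∫ ω, EWTLS.s (a i ω) (b i ω) (S i) X₀ k l ∂μ = 0) ∧
    -- `s` is half the gradient of `q` for the inner product `tr (A Bᵀ)`
    (∀ (i : ℕ) (u : Fin n → ℝ) (v : Fin d → ℝ) (X : Matrix (Fin n) (Fin d) ℝ),
      (EWTLS.ZJ J X).rank = d →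
      ∃ L : Matrix (Fin n) (Fin d) ℝ →L[ℝ] ℝ,
        HasFDerivAt (fun Y => EWTLS.q (Sum.elim u v) (S i) Y) L X ∧
        ∀ H, L H = 2 * (EWTLS.s u v (S i) X * H.transpose).trace) := by
  have hv : 0 < σ ^ 2 := by positivity
  have hcov : ∀ i j k, cov[fun ω => err i ω j, fun ω => err i ω k; μ] =
      ∫ ω, err i ω j * err i ω k ∂μ := fun i j k => by
    rw [covariance_eq_sub (h_sq i j) (h_sq i k), h_mean, zero_mul, sub_zero]
    rfl
  have hfree : ∀ i, ∀ j ∉ J, ∀ᵐ ω ∂μ, err i ω j = 0 := fun i j hj => by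
    have h1 := (integral_eq_zero_iff_of_nonneg (fun ω => sq_nonneg (err i ω j))
      (h_sq i j).integrable_sq).mp (h_free i j hj)
    filter_upwards [h1] with ω hω
    exact pow_eq_zero_iff two_ne_zero |>.mp hω
  have hSS : ∀ i j k, ∫ ω, err i ω j * err i ω k ∂μ = σ ^ 2 * S i j k := fun i j k => by
    rw [hS, Matrix.smul_apply, EWTLS.covMat, Matrix.of_apply, hcov, smul_eq_mul]
    field_simp
  have hSig : ∀ i (j k : J), ∫ ω, err i ω j * err i ω k ∂μ = σ ^ 2 * Sig i j k := fun i j k => by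
    have h1 := congrFun (congrFun (h_cov i) j) k
    rw [EWTLS.covMat, Matrix.of_apply, hcov, Matrix.smul_apply, smul_eq_mul] at h1
    exact h1
  have hSt : ∀ i, (S i).transpose = S i := fun i => by
    ext j k
    refine mul_left_cancel₀ hv.ne' ?_
    rw [Matrix.transpose_apply, ← hSS, ← hSS]
    simp only [mul_comm]
  have hSigt : ∀ i, (Sig i).transpose = Sig i := fun i => by
    ext j k
    refine mul_left_cancel₀ hv.ne' ?_
    rw [Matrix.transpose_apply, ← hSig, ← hSig]
    simp only [mul_comm]
  have hl : ∀ i, ∀ j ∉ J, ∀ k, S i j k = 0 := fun i j hj k => by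
    refine mul_left_cancel₀ hv.ne' ?_
    rw [← hSS, mul_zero]
    refine integral_eq_zero_of_ae ?_
    filter_upwards [hfree i j hj] with ω hω
    simp [hω]
  have hr : ∀ i j, ∀ k ∉ J, S i j k = 0 := fun i j k hk => by
    rw [← hSt, Matrix.transpose_apply, hl i k hk]
  have hg : ∀ i X, (EWTLS.Zmat X).transpose * S i * EWTLS.Zmat X =
      (EWTLS.ZJ J X).transpose * Sig i * EWTLS.ZJ J X := fun i X =>
    EWTLS.gram_eq_gram_ZJ X
      (fun j k => mul_left_cancel₀ hv.ne' (by rw [← hSS, ← hSig])) (hl i) (hr i)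
  obtain ⟨κ, hκ, hκle⟩ := h_lower
  have hk : 0 < κ ^ 2 := by positivity
  have hlow : ∀ i (x : J → ℝ), κ ^ 2 * (dotProduct x x) ≤ dotProduct x ((Sig i).mulVec x) :=
    fun i x => by
      have hH : (Sig i).IsHermitian := by simpa [Matrix.IsHermitian] using hSigt i
      refine le_trans ?_ (EWTLS.lambdaMin_mul_le hH x)
      exact mul_le_mul_of_nonneg_right (hκle i) (Finset.sum_nonneg fun i _ => mul_self_nonneg _)
  have hpd : ∀ i, (Sig i).PosDef := fun i => EWTLS.posDef_of_forall_le (hSigt i) hk (hlow i)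
  have hdet : ∀ i (X : Matrix (Fin n) (Fin d) ℝ), (EWTLS.ZJ J X).rank = d →
      IsUnit ((EWTLS.Zmat X).transpose * S i * EWTLS.Zmat X).det := fun i X hX => by
    rw [hg]
    exact EWTLS.isUnit_det_gram (by simpa using hX) (hpd i)
  obtain ⟨r, hr2, -, hB⟩ := h_moment
  have h4 := fun i (j : J) => EWTLS.integrable_pow_four (μ := μ) (f := fun ω => err i ω j)
    ((measurable_pi_apply _).comp (herr i)) hr2 hB.ne
    (le_iSup₂ (f := fun (i : ℕ) (j : J) => ∫⁻ ω, ‖err i ω j‖ₑ ^ (2 * r) ∂μ) i j)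
  have ha' : ∀ i ω, a i ω = fun k => EWTLS.obsRow X₀ (a₀ i) (err i ω) (Sum.inl k) :=
    fun i ω => funext (ha i ω)
  have hb' : ∀ i ω, b i ω = fun k => EWTLS.obsRow X₀ (a₀ i) (err i ω) (Sum.inr k) :=
    fun i ω => funext (hb i ω)
  refine ⟨?_, fun i k l => ?_, fun i u v X hX => EWTLS.hasFDerivAt_q (hSt i) u v X (hdet i X hX)⟩
  · obtain ⟨E, hE, hsol⟩ := EWTLS.exists_bad_event_isSolution herr h_indep h_sq h_mean hfree hv hSig
      hpd hk hlow h_rank (by positivity) (fun i j => (h4 i j).1) (fun i j => (h4 i j).2) h_vi h_vii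
      hSt hg
    have hlim : Tendsto (fun m => 1 - μ (E m)) atTop (𝓝 1) := by
      simpa using ENNReal.Tendsto.sub (tendsto_const_nhds (x := (1 : ENNReal))) hE
        (Or.inl ENNReal.one_ne_top)
    refine tendsto_of_tendsto_of_tendsto_of_le_of_le' hlim tendsto_const_nhds ?_
      (Eventually.of_forall fun m => prob_le_one)
    filter_upwards [hsol] with m hm
    have hsub : (E m)ᶜ ⊆ {ω | ∃ X : Matrix (Fin n) (Fin d) ℝ,
        est m (EWTLS.dataMat X₀ a₀ (fun i => err i ω) m) = (X : OnePoint _) ∧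
        (EWTLS.ZJ J X).rank = d ∧
        ∑ i ∈ Finset.range m, EWTLS.s (a i ω) (b i ω) (S i) X = 0} := fun ω hω => by
      obtain ⟨X, hX, hXsol⟩ := (h_est m).solves _ (hm ω hω)
      refine ⟨X, hX, ?_, ?_⟩
      · obtain ⟨ΔC, hf, -⟩ := hXsol
        exact hf.rank
      · simp only [ha', hb']
        exact EWTLS.sum_s_eq_zero_of_isSolution
          (c := fun i => EWTLS.obsRow X₀ (a₀ i) (err i ω)) hpd hSt hg hXsol
    refine le_trans ?_ (measure_mono hsub)
    -- Only subadditivity is used, so no measurability of `E m` or of the target event is required.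
    rw [tsub_le_iff_left]
    calc (1 : ENNReal) = μ (E m ∪ (E m)ᶜ) := by rw [Set.union_compl_self, measure_univ]
      _ ≤ μ (E m) + μ (E m)ᶜ := measure_union_le _ _
  · simp only [ha', hb']
    exact EWTLS.integral_s_eq_zero (a₀ i) (h_sq i) (h_mean i) (hSS i) (hdet i X₀ h_rank) k l
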